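/- Let $(X_k,Y_k)_{k\in\mathbb Z}$, with $X_k=(X_k^v)_{v\in\mathbb Z}\in\{-1,1\}^{\mathbb Z}$ and $Y_k=(Y_k^v)_{v\in\mathbb Z}\in\{-1,1\}^{\mathbb Z}$, be a hidden Markov model on a probability space $(\Omega,\mathcal F,\mathbf P)$ with transition kernel $P$ and observation kernel $\Phi$. That is, $(X_k,Y_k)_{k\in\mathbb Z}$ is a Markov chain and, for every $k\in\mathbb Z$ and every measurable $A$, $$ \mathbf P[(X_{k+1},Y_{k+1})\in A\,|\,(X_j,Y_j),\,j\le k]=\int \mathbf 1_A(z,y)\,P(X_k,dz)\,\Phi(X_k,z,dy)\quad\text{a.s.} $$ Assume the following. 1. (Locality.) $P(x,dz)=\prod_{v\in\mathbb Z}P^v(x,dz^v)$ and $\Phi(x,z,dy)=\prod_{v\in\mathbb Z}\Phi^v(x,z,dy^v)$, where $P^v,\Phi^v$ are probability kernels and $P^v(x,\cdot)$ and $\Phi^v(x,z,\cdot)$ depend only on the coordinates $x^w,z^w$ with $|w-v|\le 1$. 2. (Direct noisy observations.) $Y_k^v=X_k^v\,\xi_k^v$ for all $k,v\in\mathbb Z$,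 where $(\xi_k^v)_{k,v\in\mathbb Z}$ are i.i.d. $\{-1,1\}$-valued random variables, independent of $X=(X_k)_{k\in\mathbb Z}$, with $\mathbf P[\xi_k^v=-1]=p$. 3. (Translation invariance.) The local transition kernels are the same at every site up to translation, i.e. $P^v(x,\cdot)=P^w(\theta_{v-w}x,\cdot)$ for all $v,w\in\mathbb Z$ and all $x$, where $(\theta_a x)^u=x^{u+a}$; and the law of the random field is invariant under all space-time shifts (in particular the model is stationary): $$ (X_k^v,Y_k^v)_{k,v\in\mathbb Z}\overset{\mathrm{law}}{=}(X_{k+\ell}^{v+w},Y_{k+\ell}^{v+w})_{k,v\in\mathbb Z}\qquad\text{for all }\ell,w\in\mathbb Z. $$ If $p\ne\frac12$, then for every measurable $A\subseteq\{-1,1\}^{\mathbb Z}$ and every $v\in\mathbb Z$, $$ \big|\mathbf P[X_k\in A\,|\,X_0,Y_1,\ldots,Y_{k-1},Y_k^{<v}]-\mathbf P[X_k\in A\,|\,Y_1,\ldots,Y_{k-1},Y_k^{<v}]\big|\xrightarrow{k\to\infty}0\quad\text{in }L^1(\mathbf P), $$ where $Y_k^{<v}:=(Y_k^w)_{w<v}$.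 -/

import Mathlib

open MeasureTheory ProbabilityTheory Filter Topology

/-- The single-site state space `{-1, 1}` is the group of units `ℤˣ` of the integers;
a configuration is an element of `{-1, 1}^ℤ`, with the product σ-algebra. -/
abbrev Conf : Type := ℤ → ℤˣ

/-- `(X_k, Y_k)_{k ∈ ℤ}` is a hidden Markov model under `μ` with transition kernel `P` and
observation kernel `Φ`: the pair process is a Markov chain (with respect to the σ-algebras
generated by its past) and
`ℙ[(X_{k+1}, Y_{k+1}) ∈ A | past up to k] = ∫∫ 1_A(z, y) P(X_k, dz) Φ(X_k, z, dy)` a.s. -/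
structure IsHiddenMarkovModel {Ω S T : Type*} [MeasurableSpace Ω] [MeasurableSpace S]
    [MeasurableSpace T] (μ : Measure Ω) (P : Kernel S S) (Φ : Kernel (S × S) T)
    (X : ℤ → Ω → S) (Y : ℤ → Ω → T) : Prop where
  isMarkovKernel_transition : IsMarkovKernel P
  isMarkovKernel_observation : IsMarkovKernel Φ
  measurable_state : ∀ k, Measurable (X k)
  measurable_observation : ∀ k, Measurable (Y k)
  condProb_eq : ∀ (k : ℤ) (A : Set (S × T)), MeasurableSet A →
    μ⟦(fun ω => (X (k + 1) ω, Y (k + 1) ω)) ⁻¹' A |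
        ⨆ j : ℤ, ⨆ _ : j ≤ k, MeasurableSpace.comap (fun ω => (X j ω, Y j ω)) inferInstance⟧
      =ᵐ[μ] fun ω => ((P ⊗ₖ Φ) (X k ω)).real A

/-- The transition kernel factorizes as `P(x, dz) = ∏_v P^v(x, dz^v)`, where `P^v(x, ·)` depends
only on the coordinates `x^w` with `|w - v| ≤ 1`. -/
structure IsLocalTransition (P : Kernel Conf Conf) (Ploc : ℤ → Kernel Conf ℤˣ)
    [∀ v, IsMarkovKernel (Ploc v)] : Prop where
  factorizes : ∀ x, P x = Measure.infinitePi (fun v => Ploc v x)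
  isLocal : ∀ (v : ℤ) (x x' : Conf),
    (∀ w : ℤ, |w - v| ≤ 1 → x w = x' w) → Ploc v x = Ploc v x'

/-- The observation kernel factorizes as `Φ(x, z, dy) = ∏_v Φ^v(x, z, dy^v)`, where
`Φ^v(x, z, ·)` depends only on the coordinates `x^w`, `z^w` with `|w - v| ≤ 1`. -/
structure IsLocalObservation (Φ : Kernel (Conf × Conf) Conf) (Φloc : ℤ → Kernel (Conf × Conf) ℤˣ)
    [∀ v, IsMarkovKernel (Φloc v)] : Prop where
  factorizes : ∀ xz, Φ xz = Measure.infinitePi (fun v => Φloc v xz)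
  isLocal : ∀ (v : ℤ) (x z x' z' : Conf),
    (∀ w : ℤ, |w - v| ≤ 1 → x w = x' w ∧ z w = z' w) → Φloc v (x, z) = Φloc v (x', z')

/-- The observations are `Y_k^v = X_k^v ξ_k^v`, where the `ξ_k^v`, `k, v ∈ ℤ`, are i.i.d.
`{-1, 1}`-valued with `ℙ[ξ_k^v = -1] = p`, and the family `ξ` is independent of the process `X`. -/
structure IsDirectObservation {Ω : Type*} [MeasurableSpace Ω] (μ : Measure Ω) (p : ℝ)
    (X Y ξ : ℤ → Ω → Conf) : Prop where
  measurable_noise : ∀ k, Measurable (ξ k)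
  observation_eq : ∀ k v ω, Y k ω v = X k ω v * ξ k ω v
  noise_indep : iIndepFun (fun (q : ℤ × ℤ) ω => ξ q.1 ω q.2) μ
  noise_prob : ∀ k v, μ.real {ω | ξ k ω v = -1} = p
  noise_indep_state : IndepFun (fun ω k => ξ k ω) (fun ω k => X k ω) μ

/-- The local transition kernels do not depend on the site: `P^v` is `P^w` seen from the site `v`,
i.e. `P^v(x, ·) = P^w(θ x, ·)` with the shift `(θ x)^u = x^{u + v - w}`. -/
def IsTranslationCovariant (Ploc : ℤ → Kernel Conf ℤˣ) : Prop :=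
  ∀ (v w : ℤ) (x : Conf), Ploc v x = Ploc w (fun u => x (u + (v - w)))

/-- The law of the space-time random field `(X_k^v, Y_k^v)_{k, v ∈ ℤ}` is invariant under all
shifts in time and in space. -/
def IsTranslationInvariantLaw {Ω : Type*} [MeasurableSpace Ω] (μ : Measure Ω)
    (X Y : ℤ → Ω → Conf) : Prop :=
  ∀ l w : ℤ, IdentDistrib
    (fun ω => (fun k v => (X k ω v, Y k ω v) : ℤ → ℤ → ℤˣ × ℤˣ))
    (fun ω => (fun k v => (X (k + l) ω (v + w), Y (k + l) ω (v + w)) : ℤ → ℤ → ℤˣ × ℤˣ)) μ μ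

/-- The σ-algebra generated by `Y_1, …, Y_{k-1}` and `Y_k^{<v} = (Y_k^w)_{w < v}`. -/
@[reducible] def obsSigma {Ω : Type*} (Y : ℤ → Ω → Conf) (k v : ℤ) : MeasurableSpace Ω :=
  (⨆ j : ℤ, ⨆ _ : 1 ≤ j ∧ j ≤ k - 1, MeasurableSpace.comap (Y j) inferInstance) ⊔
    ⨆ w : ℤ, ⨆ _ : w < v, MeasurableSpace.comap (fun ω => Y k ω w) inferInstance

/-! The initial configuration has entropy at most `log 2` per site, and this budget bounds all that
it can ever reveal about the observations. Order the observations at times `≥ 1` lexicographically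
in (time, site), and let `I_k` be the conditional mutual information of `X_0` and `Y_k^v` given the
observations preceding `(k, v)`. By spatial translation invariance `I_k` does not depend on `v`. The
chain rule over a long box of sites, divided by the number of sites, gives `∑_k I_k ≤ log 2`
(`sum_condEntropy_sub_le`), so `I_k → 0`. As a finite box sees only part of `X_0` and of the past,
the full past is first cut to a window of radius `L`; the length of the box tends to infinity before
`L` does.

Since `-x log x` is strongly concave on `[0, 1]`, small information forces conditional probabilities
to be close in `L²`. With the chain rule, `X_0` becomes irrelevant for predicting functions of
finitely many `Y_k^u`, `u ≥ v` (`vanishingCondGap_obsTuple`).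

To pass from `Y_k` to `X_k`, test against products of spins over a finite set `J` of sites `≥ v`.
The noise there is independent of the conditioning, so the conditional expectation of the product
for `Y_k` is `(1 - 2p)^|J|` times that for `X_k`, and the factor is invertible because `p ≠ 1/2`.
Such products span all functions of finitely many spins (`dependsOn_induction`).

For sites to the left of `v`, start from some `v₀` to the left of all sites concerned and then add
the finitely many `Y_k^w`, `v₀ ≤ w < v`, to the conditioning by Bayes' formula
(`condGap_sup_comap_le`). Finally, cylinder sets approximate `A` uniformly in `k`, by stationarity.
-/

instance : DiscreteMeasurableSpace ℤˣ where
  forall_measurableSet s :=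
    ⟨Units.val '' s, MeasurableSet.of_discrete, Set.preimage_image_eq s Units.val_injective⟩

/-! ### Conditional expectations and Bayes' formula -/

section ConditionalExpectation

variable {Ω α β : Type*} {m m₁ m₂ m₀ : MeasurableSpace Ω} {μ : Measure Ω}

/-- A function measurable with respect to `m ⊔ σ(V)` agrees on each fiber of `V` with an
`m`-measurable function. -/
lemma exists_measurable_eq_on_fiber [MeasurableSpace α] {V : Ω → α} {h : Ω → ℝ}
    (hh : Measurable[m ⊔ MeasurableSpace.comap V inferInstance] h) (a : α) :
    ∃ g : Ω → ℝ, Measurable[m] g ∧ ∀ ω, V ω = a → h ω = g ω := by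
  have key : m ⊔ MeasurableSpace.comap V inferInstance
      = MeasurableSpace.comap (fun ω => (id ω, V ω)) (m.prod inferInstance) := by
    rw [MeasurableSpace.comap_prodMk, MeasurableSpace.comap_id]
  rw [key] at hh
  obtain ⟨H, hH, rfl⟩ :=
    @Measurable.exists_eq_measurable_comp _ _ _ (m.prod inferInstance) _ _ _ _ _ hh
  exact ⟨fun ω => H (ω, a), hH.comp (@measurable_prodMk_right _ _ m _ a), by rintro ω rfl; rfl⟩

lemma indicator_one_mul (E : Set Ω) (g : Ω → ℝ) :
    (fun ω => E.indicator (fun _ => (1 : ℝ)) ω * g ω) = E.indicator g := by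
  ext ω; by_cases h : ω ∈ E <;> simp [h]

variable [IsProbabilityMeasure μ]

lemma integral_mul_condExp (hm : m ≤ m₀) {f g : Ω → ℝ} (hf : Integrable f μ)
    (hg : Measurable[m] g) {C : ℝ} (hC : ∀ ω, |g ω| ≤ C) :
    ∫ ω, μ[f | m] ω * g ω ∂μ = ∫ ω, f ω * g ω ∂μ := by
  have h := condExp_stronglyMeasurable_mul_of_bound hm hg.stronglyMeasurable hf C
    (ae_of_all _ fun ω => by simpa using hC ω)
  rw [← integral_condExp hm (f := fun ω => f ω * g ω)]
  have e : (fun ω => f ω * g ω) = g * f := by ext; simp [mul_comm]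
  rw [e]
  refine integral_congr_ae ?_
  filter_upwards [h] with ω h
  rw [h, Pi.mul_apply, mul_comm]

lemma integrable_indicator_one {E : Set Ω} (hE : MeasurableSet[m₀] E) :
    Integrable (E.indicator fun _ => (1 : ℝ)) μ :=
  (integrable_const 1).indicator hE

lemma ae_condProb_mem_Icc {E : Set Ω} (hE : MeasurableSet[m₀] E) (hm : m ≤ m₀) :
    ∀ᵐ ω ∂μ, (μ⟦E | m⟧) ω ∈ Set.Icc (0 : ℝ) 1 :=
  (convex_Icc 0 1).condExp_mem hm (integrable_indicator_one hE) isClosed_Icc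
    (ae_of_all _ fun ω => by by_cases h : ω ∈ E <;> simp [h])

/-- Bayes' formula for conditioning on a discrete random variable in addition to `m`. -/
lemma exists_condExp_sup_comap [MeasurableSpace α] [MeasurableSingletonClass α] (hm : m ≤ m₀)
    {V : Ω → α} (hV : Measurable V) (a : α) {f : Ω → ℝ} (hf : Integrable f μ) {C : ℝ}
    (hC : 0 ≤ C) (hb : ∀ ω, |f ω| ≤ C) :
    ∃ g : Ω → ℝ, Measurable[m] g ∧ (∀ ω, |g ω| ≤ C) ∧
      (∀ᵐ ω ∂μ, V ω = a → (μ[f | m ⊔ MeasurableSpace.comap V inferInstance]) ω = g ω) ∧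
      μ[(V ⁻¹' {a}).indicator f | m] =ᵐ[μ] fun ω => g ω * (μ⟦V ⁻¹' {a} | m⟧) ω := by
  have hs : m ⊔ MeasurableSpace.comap V inferInstance ≤ m₀ := sup_le hm hV.comap_le
  obtain ⟨g, hg, hgV⟩ := exists_measurable_eq_on_fiber
    (stronglyMeasurable_condExp (μ := μ) (f := f)
      (m := m ⊔ MeasurableSpace.comap V inferInstance)).measurable a
  have hEm : MeasurableSet[m ⊔ MeasurableSpace.comap V inferInstance] (V ⁻¹' {a}) :=
    (le_sup_right : MeasurableSpace.comap V inferInstance ≤ _) _ ⟨{a}, measurableSet_singleton a, rfl⟩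
  have hE : MeasurableSet (V ⁻¹' {a}) := hs _ hEm
  have hb' : ∀ᵐ ω ∂μ, |(μ[f | m ⊔ MeasurableSpace.comap V inferInstance]) ω| ≤ C :=
    ae_bdd_abs_condExp_of_ae_bdd_abs (ae_of_all _ hb)
  -- Off the fiber `V = a` the function `g` is arbitrary; truncating it to `[-C, C]` gives a bound
  -- everywhere and a.s. changes nothing on the fiber.
  have hgm : Measurable[m] (fun ω => max (-C) (min C (g ω))) :=
    measurable_const.max (measurable_const.min hg)
  have hgb : ∀ ω, |max (-C) (min C (g ω))| ≤ C := fun ω =>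
    abs_le.2 ⟨le_max_left _ _, max_le (by linarith) (min_le_left _ _)⟩
  have hgV' : ∀ᵐ ω ∂μ, V ω = a →
      (μ[f | m ⊔ MeasurableSpace.comap V inferInstance]) ω = max (-C) (min C (g ω)) := by
    filter_upwards [hb'] with ω h hω
    rw [← hgV ω hω, min_eq_right (abs_le.1 h).2, max_eq_right (abs_le.1 h).1]
  refine ⟨_, hgm, hgb, hgV', ?_⟩
  have h1 : μ[(V ⁻¹' {a}).indicator f | m]
      =ᵐ[μ] μ[μ[(V ⁻¹' {a}).indicator f | m ⊔ MeasurableSpace.comap V inferInstance] | m] :=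
    (condExp_condExp_of_le le_sup_left hs).symm
  have h2 : μ[(V ⁻¹' {a}).indicator f | m ⊔ MeasurableSpace.comap V inferInstance]
      =ᵐ[μ] (fun ω => max (-C) (min C (g ω))) * (V ⁻¹' {a}).indicator fun _ => (1 : ℝ) := by
    filter_upwards [condExp_indicator hf hEm, hgV'] with ω h3 h4
    rw [h3, Pi.mul_apply]
    by_cases hω : ω ∈ V ⁻¹' {a}
    · simp only [Set.indicator_of_mem hω, mul_one, h4 hω]
    · simp [hω]
  exact h1.trans ((condExp_congr_ae h2).trans (condExp_stronglyMeasurable_mul_of_bound hm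
    hgm.stronglyMeasurable (integrable_indicator_one hE) C (ae_of_all _ hgb)))

end ConditionalExpectation

/-! ### Conditional Shannon entropy given a σ-algebra -/

section ConditionalEntropy

variable {Ω α β : Type*} {m m₁ m₂ m₀ : MeasurableSpace Ω}

/-- The conditional Shannon entropy of a random variable with finitely many values given a
σ-algebra. -/
noncomputable def condEntropy [Fintype α] {m₀ : MeasurableSpace Ω} (μ : Measure Ω)
    (m : MeasurableSpace Ω) (W : Ω → α) : ℝ :=
  ∑ w, ∫ ω, Real.negMulLog ((μ⟦W ⁻¹' {w} | m⟧) ω) ∂μ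

variable {μ : Measure Ω}

lemma sum_indicator_preimage_singleton [Fintype α] (W : Ω → α) (f : Ω → ℝ) :
    ∑ w, (W ⁻¹' {w}).indicator f = f := by
  classical
  ext ω
  rw [Finset.sum_apply, Finset.sum_eq_single (W ω)]
  · simp
  · intro b _ hb; simp [hb.symm]
  · simp

lemma ae_sum_condExp_indicator [Fintype α] [MeasurableSpace α] [MeasurableSingletonClass α]
    {W : Ω → α} (hW : Measurable W) {f : Ω → ℝ}
    (hf : Integrable f μ) :
    ∀ᵐ ω ∂μ, ∑ w, (μ[(W ⁻¹' {w}).indicator f | m]) ω = (μ[f | m]) ω := by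
  have h := condExp_finsetSum (μ := μ) (m := m) (s := Finset.univ)
    (f := fun w => (W ⁻¹' {w}).indicator f)
    (fun w _ => hf.indicator (hW (measurableSet_singleton w)))
  rw [sum_indicator_preimage_singleton] at h
  filter_upwards [h] with ω h
  rw [h, Finset.sum_apply]

lemma condEntropy_equiv {α' : Type*} [Fintype α] [Fintype α'] (e : α ≃ α') (W : Ω → α) :
    condEntropy μ m (fun ω => e (W ω)) = condEntropy μ m W := by
  unfold condEntropy
  rw [← e.sum_comp]
  refine Finset.sum_congr rfl fun w _ => ?_
  have : (fun ω => e (W ω)) ⁻¹' {e w} = W ⁻¹' {w} := by ext; simp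
  rw [this]

variable [IsProbabilityMeasure μ]

lemma exists_abs_negMulLog_le (C : ℝ) : ∃ K, ∀ x, |x| ≤ C → |Real.negMulLog x| ≤ K := by
  obtain ⟨K, hK⟩ := (isCompact_Icc (a := -C) (b := C)).exists_bound_of_continuousOn
    Real.continuous_negMulLog.continuousOn
  exact ⟨K, fun x hx => hK x (abs_le.1 hx)⟩

lemma integrable_of_measurable_of_bound {f : Ω → ℝ} (hm : m ≤ m₀) (hf : Measurable[m] f) {C : ℝ}
    (hC : ∀ᵐ ω ∂μ, |f ω| ≤ C) : Integrable f μ :=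
  Integrable.of_bound (hf.mono hm le_rfl).aestronglyMeasurable C hC

lemma integrable_negMulLog_condProb {E : Set Ω} (hE : MeasurableSet[m₀] E) (hm : m ≤ m₀) :
    Integrable (fun ω => Real.negMulLog ((μ⟦E | m⟧) ω)) μ := by
  obtain ⟨K, hK⟩ := exists_abs_negMulLog_le 1
  refine integrable_of_measurable_of_bound (C := K) hm
    (Real.continuous_negMulLog.measurable.comp stronglyMeasurable_condExp.measurable) ?_
  filter_upwards [ae_condProb_mem_Icc hE hm] with ω h
  exact hK _ (abs_le.2 ⟨by linarith [h.1], h.2⟩)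

variable [Fintype α] [MeasurableSpace α] [MeasurableSingletonClass α]

lemma condEntropy_nonneg (hm : m ≤ m₀) {W : Ω → α} (hW : Measurable W) :
    0 ≤ condEntropy μ m W := by
  refine Finset.sum_nonneg fun w _ => integral_nonneg_of_ae ?_
  filter_upwards [ae_condProb_mem_Icc (hW (measurableSet_singleton w)) hm] with ω h
  exact Real.negMulLog_nonneg h.1 h.2

/-- Pointwise Jensen for `Real.negMulLog` with uniform weights, since the conditional probabilities
sum to one. -/
lemma condEntropy_le_log_card (hm : m ≤ m₀) {W : Ω → α} (hW : Measurable W) :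
    condEntropy μ m W ≤ Real.log (Fintype.card α) := by
  have hne : Nonempty α := by
    have := (inferInstance : IsProbabilityMeasure μ).neZero
    obtain ⟨ω⟩ := nonempty_of_isProbabilityMeasure μ
    exact ⟨W ω⟩
  have hN : (0 : ℝ) < Fintype.card α := by exact_mod_cast Fintype.card_pos
  have hE := fun w => hW (measurableSet_singleton w)
  unfold condEntropy
  rw [← integral_finsetSum _ fun w _ => integrable_negMulLog_condProb (hE w) hm]
  have hint : ∫ _ : Ω, Real.log (Fintype.card α) ∂μ = Real.log (Fintype.card α) := by simp
  rw [← hint]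
  refine integral_mono_ae (integrable_finsetSum _ fun w _ =>
    integrable_negMulLog_condProb (hE w) hm) (integrable_const _) ?_
  filter_upwards [ae_all_iff.2 fun w => ae_condProb_mem_Icc (μ := μ) (hE w) hm,
    ae_sum_condExp_indicator (m := m) (μ := μ) hW (integrable_const (1 : ℝ))] with ω h1 h2
  have h3 := Real.concaveOn_negMulLog.le_map_sum (t := Finset.univ)
    (w := fun _ : α => (Fintype.card α : ℝ)⁻¹) (p := fun w => (μ⟦W ⁻¹' {w} | m⟧) ω)
    (fun _ _ => by positivity) (by simp [Finset.card_univ, hN.ne']) (fun w _ => (h1 w).1)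
  simp only [smul_eq_mul, ← Finset.mul_sum] at h3
  rw [h2, condExp_const hm] at h3
  simp only [mul_one, Real.negMulLog, Real.log_inv] at h3
  have h4 : (Fintype.card α : ℝ)⁻¹ * ∑ w, Real.negMulLog ((μ⟦W ⁻¹' {w} | m⟧) ω)
      ≤ (Fintype.card α : ℝ)⁻¹ * Real.log (Fintype.card α) := by
    refine h3.trans (le_of_eq (by ring))
  exact le_of_mul_le_mul_left h4 (by positivity)

/-- The chain rule for conditional entropy. -/
lemma condEntropy_prodMk [Fintype β] [MeasurableSpace β] [MeasurableSingletonClass β]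
    (hm : m ≤ m₀) {W : Ω → α} (hW : Measurable W) {V : Ω → β}
    (hV : Measurable V) :
    condEntropy μ m (fun ω => (W ω, V ω))
      = condEntropy μ m V + condEntropy μ (m ⊔ MeasurableSpace.comap V inferInstance) W := by
  have hs : m ⊔ MeasurableSpace.comap V inferInstance ≤ m₀ := sup_le hm hV.comap_le
  have hEW := fun w => hW (measurableSet_singleton w)
  have hEV := fun a => hV (measurableSet_singleton a)
  have key := fun (w : α) (a : β) => exists_condExp_sup_comap (μ := μ) hm hV a
    (integrable_indicator_one (hEW w)) zero_le_one
    (fun ω => by by_cases h : ω ∈ W ⁻¹' {w} <;> simp [h])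
  choose g hgm hgb hgV hgE using key
  set b := fun a => μ⟦V ⁻¹' {a} | m⟧ with hb
  obtain ⟨K, hK⟩ := exists_abs_negMulLog_le 1
  have hφg : ∀ w a, Measurable[m] fun ω => Real.negMulLog (g w a ω) := fun w a =>
    Real.continuous_negMulLog.measurable.comp (hgm w a)
  have hbm : ∀ a, Measurable[m] (b a) := fun a => stronglyMeasurable_condExp.measurable
  have hbb : ∀ a, ∀ᵐ ω ∂μ, b a ω ∈ Set.Icc (0 : ℝ) 1 := fun a => ae_condProb_mem_Icc (hEV a) hm
  have hi1 : ∀ w a, Integrable (fun ω => b a ω * Real.negMulLog (g w a ω)) μ := fun w a => by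
    refine integrable_of_measurable_of_bound (C := K) hm ((hbm a).mul (hφg w a)) ?_
    filter_upwards [hbb a] with ω h
    rw [abs_mul, abs_of_nonneg h.1]
    have := hK _ (hgb w a ω)
    nlinarith [h.1, h.2, abs_nonneg (Real.negMulLog (g w a ω))]
  have hi2 : ∀ w a, Integrable (fun ω => g w a ω * Real.negMulLog (b a ω)) μ := fun w a => by
    refine integrable_of_measurable_of_bound (C := K) hm
      ((hgm w a).mul (Real.continuous_negMulLog.measurable.comp (hbm a))) ?_
    filter_upwards [hbb a] with ω h
    rw [abs_mul]
    have h1 := hK (b a ω) (abs_le.2 ⟨by linarith [h.1], h.2⟩)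
    have h2 := hgb w a ω
    nlinarith [abs_nonneg (Real.negMulLog (b a ω)), abs_nonneg (g w a ω)]
  -- With `b` the conditional law of `V` and `g` that of `W` on `V = a`, the joint probability is `g
  -- * b`, and `-gb log (gb)` splits into `b (-g log g) + g (-b log b)`.
  have hleft : ∀ w a, ∫ ω, Real.negMulLog
      ((μ⟦(fun ω => (W ω, V ω)) ⁻¹' {(w, a)} | m⟧) ω) ∂μ
      = ∫ ω, b a ω * Real.negMulLog (g w a ω) ∂μ
        + ∫ ω, g w a ω * Real.negMulLog (b a ω) ∂μ := fun w a => by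
    rw [← integral_add (hi1 w a) (hi2 w a)]
    refine integral_congr_ae ?_
    have e : ((fun ω => (W ω, V ω)) ⁻¹' {(w, a)}).indicator (fun _ => (1 : ℝ))
        = (V ⁻¹' {a}).indicator ((W ⁻¹' {w}).indicator fun _ => (1 : ℝ)) := by
      rw [Set.indicator_indicator]
      congr 1
      ext ω
      simp [and_comm]
    rw [e]
    filter_upwards [hgE w a] with ω h
    rw [h, Real.negMulLog_mul]
  have hright : ∀ w, ∫ ω, Real.negMulLog
      ((μ⟦W ⁻¹' {w} | m ⊔ MeasurableSpace.comap V inferInstance⟧) ω) ∂μ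
      = ∑ a, ∫ ω, b a ω * Real.negMulLog (g w a ω) ∂μ := fun w => by
    have e : ∀ a, ∫ ω, b a ω * Real.negMulLog (g w a ω) ∂μ
        = ∫ ω, (V ⁻¹' {a}).indicator (fun ω => Real.negMulLog
          ((μ⟦W ⁻¹' {w} | m ⊔ MeasurableSpace.comap V inferInstance⟧) ω)) ω ∂μ := fun a => by
      rw [integral_mul_condExp hm (integrable_indicator_one (hEV a)) (hφg w a)
        fun ω => hK _ (hgb w a ω), indicator_one_mul]
      refine integral_congr_ae ?_
      filter_upwards [hgV w a] with ω h
      by_cases hω : V ω = a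
      · simp only [Set.indicator_of_mem (show ω ∈ V ⁻¹' {a} from hω), h hω]
      · simp only [Set.indicator_of_notMem (show ω ∉ V ⁻¹' {a} from hω)]
    simp only [e]
    rw [← integral_finsetSum _ fun a _ =>
      (integrable_negMulLog_condProb (hEW w) hs).indicator (hEV a)]
    congr 1
    ext ω
    rw [← Finset.sum_apply, sum_indicator_preimage_singleton]
  have hsum : ∀ a, ∑ w, ∫ ω, g w a ω * Real.negMulLog (b a ω) ∂μ
      = ∫ ω, Real.negMulLog (b a ω) ∂μ := fun a => by
    rw [← integral_finsetSum _ fun w _ => hi2 w a]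
    refine integral_congr_ae ?_
    have h := ae_sum_condExp_indicator (m := m) (μ := μ) hW (integrable_indicator_one (hEV a))
    filter_upwards [h, ae_all_iff.2 fun w => hgE w a] with ω h h2
    have e : ∀ w, (V ⁻¹' {a}).indicator ((W ⁻¹' {w}).indicator fun _ => (1 : ℝ))
        = (W ⁻¹' {w}).indicator ((V ⁻¹' {a}).indicator fun _ => (1 : ℝ)) := fun w => by
      rw [Set.indicator_indicator, Set.indicator_indicator, Set.inter_comm]
    simp only [e] at h2
    simp only [h2, ← Finset.sum_mul] at h
    rw [← Finset.sum_mul]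
    change _ * b a ω = b a ω at h
    -- The `g w a` sum to one only where `b a` is nonzero; elsewhere `negMulLog 0 = 0` makes both
    -- sides vanish.
    by_cases h0 : b a ω = 0
    · simp [h0]
    · rw [mul_eq_right₀ h0] at h
      rw [h, one_mul]
  unfold condEntropy
  rw [Fintype.sum_prod_type]
  simp only [hleft, hright, Finset.sum_add_distrib]
  rw [add_comm, Finset.sum_comm]
  simp only [hsum]
  rfl

/-- Symmetry of conditional mutual information. -/
lemma condEntropy_sub_comm [Fintype β] [MeasurableSpace β] [MeasurableSingletonClass β]
    (hm : m ≤ m₀) {W : Ω → α} (hW : Measurable W) {V : Ω → β}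
    (hV : Measurable V) :
    condEntropy μ m W - condEntropy μ (m ⊔ MeasurableSpace.comap V inferInstance) W
      = condEntropy μ m V - condEntropy μ (m ⊔ MeasurableSpace.comap W inferInstance) V := by
  have h1 := condEntropy_prodMk (μ := μ) hm hW hV
  have h2 := condEntropy_prodMk (μ := μ) hm hV hW
  have h3 := condEntropy_equiv (μ := μ) (m := m) (Equiv.prodComm α β) (fun ω => (W ω, V ω))
  simp only [Equiv.prodComm_apply, Prod.swap_prod_mk] at h3
  linarith

/-- The second derivative is `1 - 1/x ≤ 0` on `(0, 1)`. This strong concavity of `-x log x` plays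
the role of Pinsker's inequality. -/
lemma concaveOn_negMulLog_add_sq :
    ConcaveOn ℝ (Set.Icc 0 1) fun x => Real.negMulLog x + x ^ 2 / 2 := by
  refine concaveOn_of_deriv2_nonpos (convex_Icc 0 1) (by fun_prop) ?_ ?_ ?_
  · intro x hx
    rw [interior_Icc] at hx
    exact ((Real.hasDerivAt_negMulLog hx.1.ne').add
      ((hasDerivAt_pow 2 x).div_const 2)).differentiableAt.differentiableWithinAt
  all_goals
    have h1 : ∀ x ∈ Set.Ioo (0 : ℝ) 1, HasDerivAt (fun x => Real.negMulLog x + x ^ 2 / 2)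
        (-Real.log x - 1 + x) x := fun x hx => by
      have := (Real.hasDerivAt_negMulLog hx.1.ne').add ((hasDerivAt_pow 2 x).div_const 2)
      exact this.congr_deriv (by ring)
    have h2 : ∀ x ∈ Set.Ioo (0 : ℝ) 1,
        HasDerivAt (deriv fun x => Real.negMulLog x + x ^ 2 / 2) (-x⁻¹ + 1) x := fun x hx => by
      have h3 : HasDerivAt (fun x => -Real.log x - 1 + x) (-x⁻¹ + 1) x :=
        (((Real.hasDerivAt_log hx.1.ne').neg).sub_const 1).add (hasDerivAt_id x)
      refine h3.congr_of_eventuallyEq ?_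
      filter_upwards [Ioo_mem_nhds hx.1 hx.2] with y hy using (h1 y hy).deriv
    intro x hx
    rw [interior_Icc] at hx
  · exact (h2 x hx).differentiableAt.differentiableWithinAt
  · rw [Function.iterate_succ, Function.iterate_one, Function.comp_apply, (h2 x hx).deriv]
    have : 1 ≤ x⁻¹ := (one_le_inv₀ hx.1).2 hx.2.le
    linarith

/-- Conditional Jensen for the concave function `-x log x + x²/2`, where the quadratic terms combine
by orthogonality of martingale increments: `∫ (p₂ - p₁)² = ∫ p₂² - ∫ p₁²`. -/
lemma integral_negMulLog_condProb_add_le (h12 : m₁ ≤ m₂) (h2 : m₂ ≤ m₀) {E : Set Ω}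
    (hE : MeasurableSet[m₀] E) :
    ∫ ω, Real.negMulLog ((μ⟦E | m₂⟧) ω) ∂μ
        + (∫ ω, ((μ⟦E | m₂⟧) ω - (μ⟦E | m₁⟧) ω) ^ 2 ∂μ) / 2
      ≤ ∫ ω, Real.negMulLog ((μ⟦E | m₁⟧) ω) ∂μ := by
  have h1 := h12.trans h2
  set p₁ := μ⟦E | m₁⟧ with hp₁
  set p₂ := μ⟦E | m₂⟧ with hp₂
  have hb1 : ∀ᵐ ω ∂μ, p₁ ω ∈ Set.Icc (0 : ℝ) 1 := ae_condProb_mem_Icc hE h1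
  have hb2 : ∀ᵐ ω ∂μ, p₂ ω ∈ Set.Icc (0 : ℝ) 1 := ae_condProb_mem_Icc hE h2
  have hm1 : Measurable[m₁] p₁ := stronglyMeasurable_condExp.measurable
  have hm2 : Measurable[m₂] p₂ := stronglyMeasurable_condExp.measurable
  have hm1' : Measurable p₁ := hm1.mono h1 le_rfl
  have hm2' : Measurable p₂ := hm2.mono h2 le_rfl
  have htower : μ[p₂ | m₁] =ᵐ[μ] p₁ := condExp_condExp_of_le h12 h2
  have hi2 : Integrable p₂ μ := integrable_condExp
  have hφ1 : Integrable (fun ω => Real.negMulLog (p₁ ω)) μ := integrable_negMulLog_condProb hE h1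
  have hφ2 : Integrable (fun ω => Real.negMulLog (p₂ ω)) μ := integrable_negMulLog_condProb hE h2
  have hint : ∀ {f : Ω → ℝ}, Measurable f → (∀ᵐ ω ∂μ, |f ω| ≤ 1) → Integrable f μ :=
    fun hf hb => integrable_of_measurable_of_bound le_rfl hf hb
  have hs1 : Integrable (fun ω => p₁ ω ^ 2) μ := hint (hm1'.pow_const 2) (by
    filter_upwards [hb1] with ω h
    rw [abs_of_nonneg (sq_nonneg _)]; nlinarith [h.1, h.2])
  have hs2 : Integrable (fun ω => p₂ ω ^ 2) μ := hint (hm2'.pow_const 2) (by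
    filter_upwards [hb2] with ω h
    rw [abs_of_nonneg (sq_nonneg _)]; nlinarith [h.1, h.2])
  have hs12 : Integrable (fun ω => p₂ ω * p₁ ω) μ := hint (hm2'.mul hm1') (by
    filter_upwards [hb1, hb2] with ω h h'
    rw [abs_of_nonneg (mul_nonneg h'.1 h.1)]; nlinarith [h.1, h.2, h'.1, h'.2])
  have hcross : ∫ ω, p₂ ω * p₁ ω ∂μ = ∫ ω, p₁ ω ^ 2 ∂μ := by
    have hpull := condExp_mul_of_stronglyMeasurable_right (m := m₁) (μ := μ) (f := p₂) (g := p₁)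
      hm1.stronglyMeasurable hs12 hi2
    rw [← integral_condExp h1 (f := fun ω => p₂ ω * p₁ ω)]
    refine integral_congr_ae ?_
    filter_upwards [hpull, htower] with ω h h'
    rw [show (fun ω => p₂ ω * p₁ ω) = p₂ * p₁ from rfl, h, Pi.mul_apply, h', sq]
  have hsq : ∫ ω, (p₂ ω - p₁ ω) ^ 2 ∂μ = ∫ ω, p₂ ω ^ 2 ∂μ - ∫ ω, p₁ ω ^ 2 ∂μ := by
    have e : ∀ ω, (p₂ ω - p₁ ω) ^ 2 = p₂ ω ^ 2 - 2 * (p₂ ω * p₁ ω) + p₁ ω ^ 2 := fun ω => by ring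
    simp only [e]
    have h3 : ∫ ω, (p₂ ω ^ 2 - 2 * (p₂ ω * p₁ ω) + p₁ ω ^ 2) ∂μ
        = ∫ ω, (p₂ ω ^ 2 - 2 * (p₂ ω * p₁ ω)) ∂μ + ∫ ω, p₁ ω ^ 2 ∂μ :=
      integral_add (hs2.sub (hs12.const_mul 2)) hs1
    rw [h3, integral_sub hs2 (hs12.const_mul 2), integral_const_mul, hcross]
    ring
  have hJ := concaveOn_negMulLog_add_sq.condExp_map_le (μ := μ) (f := p₂) h1
    (by fun_prop : Continuous fun x : ℝ => Real.negMulLog x + x ^ 2 / 2).continuousOn.upperSemicontinuousOn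
    hb2 isClosed_Icc hi2 (hφ2.add (hs2.div_const 2))
  have hJ' : ∫ ω, (Real.negMulLog (p₂ ω) + p₂ ω ^ 2 / 2) ∂μ
      ≤ ∫ ω, (Real.negMulLog (p₁ ω) + p₁ ω ^ 2 / 2) ∂μ := by
    rw [← integral_condExp h1 (f := fun ω => Real.negMulLog (p₂ ω) + p₂ ω ^ 2 / 2)]
    refine integral_mono_ae integrable_condExp (hφ1.add (hs1.div_const 2)) ?_
    filter_upwards [hJ, htower] with ω h h'
    simpa [Function.comp_apply, h'] using! h
  rw [integral_add hφ2 (hs2.div_const 2), integral_add hφ1 (hs1.div_const 2), integral_div,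
    integral_div] at hJ'
  rw [hsq]
  linarith

lemma condEntropy_anti (h12 : m₁ ≤ m₂) (h2 : m₂ ≤ m₀) {W : Ω → α} (hW : Measurable W) :
    condEntropy μ m₂ W ≤ condEntropy μ m₁ W := by
  refine Finset.sum_le_sum fun w _ => ?_
  have h := integral_negMulLog_condProb_add_le (μ := μ) h12 h2 (hW (measurableSet_singleton w))
  have : 0 ≤ ∫ ω, ((μ⟦W ⁻¹' {w} | m₂⟧) ω - (μ⟦W ⁻¹' {w} | m₁⟧) ω) ^ 2 ∂μ :=
    integral_nonneg fun _ => sq_nonneg _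
  linarith

/-- The conditional information controls the distance between conditional probabilities. -/
lemma integral_sq_condProb_sub_le (h12 : m₁ ≤ m₂) (h2 : m₂ ≤ m₀) {W : Ω → α} (hW : Measurable W)
    (w : α) :
    (∫ ω, ((μ⟦W ⁻¹' {w} | m₂⟧) ω - (μ⟦W ⁻¹' {w} | m₁⟧) ω) ^ 2 ∂μ) / 2
      ≤ condEntropy μ m₁ W - condEntropy μ m₂ W := by
  unfold condEntropy
  rw [← Finset.sum_sub_distrib]
  have h : ∀ w, (∫ ω, ((μ⟦W ⁻¹' {w} | m₂⟧) ω - (μ⟦W ⁻¹' {w} | m₁⟧) ω) ^ 2 ∂μ) / 2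
      ≤ ∫ ω, Real.negMulLog ((μ⟦W ⁻¹' {w} | m₁⟧) ω) ∂μ
        - ∫ ω, Real.negMulLog ((μ⟦W ⁻¹' {w} | m₂⟧) ω) ∂μ := fun w => by
    have := integral_negMulLog_condProb_add_le (μ := μ) h12 h2 (hW (measurableSet_singleton w))
    linarith
  refine (h w).trans (Finset.single_le_sum (f := fun w => ∫ ω, Real.negMulLog
    ((μ⟦W ⁻¹' {w} | m₁⟧) ω) ∂μ - ∫ ω, Real.negMulLog ((μ⟦W ⁻¹' {w} | m₂⟧) ω) ∂μ)
    (fun w _ => le_trans ?_ (h w)) (Finset.mem_univ w))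
  exact div_nonneg (integral_nonneg fun _ => sq_nonneg _) zero_le_two

/-- Continuity of conditional entropy along an increasing sequence of σ-algebras. -/
lemma tendsto_condEntropy (ℱ : ℕ → MeasurableSpace Ω) (hmono : Monotone ℱ) (hle : ∀ n, ℱ n ≤ m₀)
    {W : Ω → α} (hW : Measurable W) :
    Tendsto (fun n => condEntropy μ (ℱ n) W) atTop (𝓝 (condEntropy μ (⨆ n, ℱ n) W)) := by
  refine tendsto_finsetSum _ fun w _ => ?_
  have hE := hW (measurableSet_singleton w)
  obtain ⟨K, hK⟩ := exists_abs_negMulLog_le 1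
  refine tendsto_integral_of_dominated_convergence (fun _ => K)
    (fun n => (integrable_negMulLog_condProb hE (hle n)).aestronglyMeasurable)
    (integrable_const K) (fun n => ?_) ?_
  · filter_upwards [ae_condProb_mem_Icc hE (hle n)] with ω h
    exact hK _ (abs_le.2 ⟨by linarith [h.1], h.2⟩)
  · filter_upwards [tendsto_ae_condExp (μ := μ) (ℱ := ⟨ℱ, hmono, hle⟩)
      ((W ⁻¹' {w}).indicator fun _ => (1 : ℝ))] with ω h
    exact (Real.continuous_negMulLog.tendsto _).comp h

/-- Conditional expectations given `σ(Z)` are computed under the law of `Z`. -/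
lemma condExp_comp_comap {S : Type*} {n mS : MeasurableSpace S} {Z : Ω → S} (hn : n ≤ mS)
    (hZ : Measurable Z) {f : S → ℝ} (hf : Integrable f (μ.map Z)) :
    μ[fun ω => f (Z ω) | n.comap Z] =ᵐ[μ] fun ω => ((μ.map Z)[f | n]) (Z ω) := by
  have := Measure.isProbabilityMeasure_map (μ := μ) hZ.aemeasurable
  have hle : n.comap Z ≤ m₀ := (MeasurableSpace.comap_mono hn).trans hZ.comap_le
  have hi : Integrable (fun ω => ((μ.map Z)[f | n]) (Z ω)) μ :=
    (integrable_condExp (μ := μ.map Z) (f := f) (m := n)).comp_measurable hZ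
  refine (ae_eq_condExp_of_forall_setIntegral_eq hle (hf.comp_measurable hZ)
    (fun _ _ _ => hi.integrableOn) ?_ ?_).symm
  · rintro _ ⟨t, ht, rfl⟩ _
    change _ = ∫ ω in Z ⁻¹' t, f (Z ω) ∂μ
    rw [← setIntegral_map (hn _ ht) integrable_condExp.aestronglyMeasurable hZ.aemeasurable,
      ← setIntegral_map (hn _ ht) hf.aestronglyMeasurable hZ.aemeasurable,
      setIntegral_condExp hn hf ht]
  · exact (StronglyMeasurable.comp_measurable (stronglyMeasurable_condExp (μ := μ.map Z) (f := f)
      (m := n)) (Measurable.of_comap_le le_rfl)).aestronglyMeasurable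

lemma condEntropy_comp_comap {S : Type*} {n mS : MeasurableSpace S} {Z : Ω → S} (hn : n ≤ mS)
    (hZ : Measurable Z) {W : S → α} (hW : Measurable W) :
    condEntropy μ (n.comap Z) (fun ω => W (Z ω)) = condEntropy (μ.map Z) n W := by
  have := Measure.isProbabilityMeasure_map (μ := μ) hZ.aemeasurable
  refine Finset.sum_congr rfl fun w _ => ?_
  have hE := hW (measurableSet_singleton w)
  rw [integral_map hZ.aemeasurable (integrable_negMulLog_condProb hE hn).aestronglyMeasurable]
  refine integral_congr_ae ?_
  filter_upwards [condExp_comp_comap (μ := μ) hn hZ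
    (integrable_indicator_one (μ := μ.map Z) hE)] with ω h
  rw [← h]
  rfl

end ConditionalEntropy

/-! ### σ-algebras generated by parts of a random field -/

section FieldSigma

variable {Ω ι κ : Type*} {m₀ : MeasurableSpace Ω} {μ : Measure Ω}

/-- The σ-algebra generated by the part of a random field with indices in `S`. -/
@[reducible] def fieldSigma (Z : ι → Ω → ℤˣ) (S : Set ι) : MeasurableSpace Ω :=
  ⨆ i ∈ S, MeasurableSpace.comap (Z i) inferInstance

lemma fieldSigma_mono (Z : ι → Ω → ℤˣ) {S T : Set ι} (h : S ⊆ T) :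
    fieldSigma Z S ≤ fieldSigma Z T :=
  biSup_mono h

lemma fieldSigma_le {Z : ι → Ω → ℤˣ} (hZ : ∀ i, Measurable (Z i)) (S : Set ι) :
    fieldSigma Z S ≤ m₀ :=
  iSup₂_le fun i _ => (hZ i).comap_le

lemma fieldSigma_union (Z : ι → Ω → ℤˣ) (S T : Set ι) :
    fieldSigma Z (S ∪ T) = fieldSigma Z S ⊔ fieldSigma Z T :=
  iSup_union

lemma fieldSigma_iUnion (Z : ι → Ω → ℤˣ) (S : κ → Set ι) :
    fieldSigma Z (⋃ n, S n) = ⨆ n, fieldSigma Z (S n) := by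
  unfold fieldSigma
  simp only [Set.mem_iUnion, iSup_exists]
  exact iSup_comm

lemma fieldSigma_insert (Z : ι → Ω → ℤˣ) (S : Set ι) (i : ι) :
    fieldSigma Z (insert i S) = fieldSigma Z S ⊔ MeasurableSpace.comap (Z i) inferInstance := by
  rw [← Set.union_singleton, fieldSigma_union]
  simp [fieldSigma]

lemma measurable_fieldSigma (Z : ι → Ω → ℤˣ) {S : Set ι} {i : ι} (hi : i ∈ S) :
    Measurable[fieldSigma Z S] (Z i) :=
  Measurable.of_comap_le
    (le_biSup (f := fun i => MeasurableSpace.comap (Z i) inferInstance) hi)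

lemma comap_tuple (Z : ι → Ω → ℤˣ) (e : κ → ι) :
    MeasurableSpace.comap (fun ω i => Z (e i) ω) inferInstance
      = fieldSigma Z (Set.range e) := by
  unfold fieldSigma
  rw [iSup_range, MeasurableSpace.pi, MeasurableSpace.comap_iSup]
  simp only [MeasurableSpace.comap_comp]
  rfl

lemma fieldSigma_eq_comap (Z : ι → Ω → ℤˣ) (S : Set ι) :
    fieldSigma Z S = (fieldSigma (fun i (x : ι → ℤˣ) => x i) S).comap fun ω i => Z i ω := by
  simp only [fieldSigma, MeasurableSpace.comap_iSup, MeasurableSpace.comap_comp]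
  rfl

lemma fieldSigma_comp (Z : ι → Ω → ℤˣ) (τ : κ → ι) (S : Set κ) :
    fieldSigma (fun i => Z (τ i)) S = fieldSigma Z (τ '' S) := by
  simp only [fieldSigma, iSup_image]

/-- Both entropies can be computed on the canonical space `ι → ℤˣ`, under the laws of the field and
of the reindexed field, which agree. -/
lemma condEntropy_field_shift [IsProbabilityMeasure μ] {Z : ι → Ω → ℤˣ}
    (hZ : ∀ i, Measurable (Z i)) {τ : ι → ι}
    (hτ : IdentDistrib (fun ω i => Z i ω) (fun ω i => Z (τ i) ω) μ μ) (S : Set ι) (i : ι) :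
    condEntropy μ (fieldSigma Z (τ '' S)) (Z (τ i)) = condEntropy μ (fieldSigma Z S) (Z i) := by
  have hle : fieldSigma (fun i (x : ι → ℤˣ) => x i) S ≤ MeasurableSpace.pi :=
    fieldSigma_le (fun i => measurable_pi_apply i) S
  have h1 := condEntropy_comp_comap (μ := μ) hle (measurable_pi_lambda _ hZ)
    (measurable_pi_apply i)
  have h2 := condEntropy_comp_comap (μ := μ) hle (measurable_pi_lambda _ fun i => hZ (τ i))
    (measurable_pi_apply i)
  rw [← fieldSigma_eq_comap Z] at h1
  rw [← fieldSigma_eq_comap (fun i => Z (τ i)), fieldSigma_comp, ← hτ.map_eq] at h2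
  exact h2.trans h1.symm

end FieldSigma

/-! ### The entropy budget: information from the initial state is summable in time -/

section SpaceTime

/-- Space-time indices: `Sum.inl w` stands for the initial state at the site `w`, and
`Sum.inr (k, w)` for the observation at time `k` and site `w`. -/
abbrev SpaceTime : Type := ℤ ⊕ (ℤ × ℤ)

/-- The observations at positive times that precede the site `v` at time `k` lexicographically. -/
def obsPast (k v : ℤ) : Set SpaceTime :=
  {i | i.elim (fun _ => False) fun q => (1 ≤ q.1 ∧ q.1 ≤ k - 1) ∨ (q.1 = k ∧ q.2 < v)}

/-- The initial state together with `obsPast k v`. -/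
def fullPast (k v : ℤ) : Set SpaceTime :=
  {i | i.elim (fun _ => True) fun q => (1 ≤ q.1 ∧ q.1 ≤ k - 1) ∨ (q.1 = k ∧ q.2 < v)}

/-- The part of `fullPast k v` at sites within distance `L` of `v`. -/
def windowPast (L k v : ℤ) : Set SpaceTime :=
  {i | i.elim (fun w => |w - v| ≤ L) fun q =>
    |q.2 - v| ≤ L ∧ ((1 ≤ q.1 ∧ q.1 ≤ k - 1) ∨ (q.1 = k ∧ q.2 < v))}

/-- The part of `obsPast k v` at sites in `[a, b)`. -/
def boxPast (a b k v : ℤ) : Set SpaceTime :=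
  {i | i.elim (fun _ => False) fun q =>
    (a ≤ q.2 ∧ q.2 < b) ∧ ((1 ≤ q.1 ∧ q.1 ≤ k - 1) ∨ (q.1 = k ∧ q.2 < v))}

/-- The spatial shift by `w` of the space-time indices. -/
def spaceShift (w : ℤ) : SpaceTime → SpaceTime :=
  Sum.map (· + w) fun q => (q.1, q.2 + w)

lemma spaceShift_image {w : ℤ} {S T : Set SpaceTime}
    (h : ∀ i, spaceShift w i ∈ T ↔ i ∈ S) : spaceShift w '' S = T := by
  have hinv : ∀ i, spaceShift w (spaceShift (-w) i) = i := by
    rintro (u | ⟨j, u⟩) <;> simp [spaceShift]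
  ext i
  constructor
  · rintro ⟨i, hi, rfl⟩
    exact (h i).2 hi
  · intro hi
    exact ⟨spaceShift (-w) i, (h _).1 (by rwa [hinv]), hinv i⟩

lemma spaceShift_image_obsPast (w k v : ℤ) :
    spaceShift w '' obsPast k v = obsPast k (v + w) :=
  spaceShift_image (by rintro (u | ⟨j, u⟩) <;> simp [spaceShift, obsPast])

lemma spaceShift_image_fullPast (w k v : ℤ) :
    spaceShift w '' fullPast k v = fullPast k (v + w) :=
  spaceShift_image (by rintro (u | ⟨j, u⟩) <;> simp [spaceShift, fullPast])

lemma spaceShift_image_windowPast (w L k v : ℤ) :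
    spaceShift w '' windowPast L k v = windowPast L k (v + w) :=
  spaceShift_image (by rintro (u | ⟨j, u⟩) <;> simp [spaceShift, windowPast])

lemma iUnion_windowPast (k v : ℤ) : ⋃ L : ℕ, windowPast L k v = fullPast k v := by
  ext i
  rw [Set.mem_iUnion]
  rcases i with u | ⟨j, u⟩ <;> simp only [windowPast, fullPast, Set.mem_ofPred_eq, Sum.elim_inl,
    Sum.elim_inr]
  · exact ⟨fun _ => trivial, fun _ => ⟨(u - v).natAbs, by simp⟩⟩
  · exact ⟨fun ⟨_, h⟩ => h.2, fun h => ⟨(u - v).natAbs, by simp, h⟩⟩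

lemma windowPast_mono (k v : ℤ) : Monotone fun L : ℕ => windowPast L k v := by
  rintro L L' hL (u | ⟨j, u⟩) h
  · have h' : |u - v| ≤ L := h
    exact h'.trans (by exact_mod_cast hL)
  · have h' : |u - v| ≤ L := h.1
    exact ⟨h'.trans (by exact_mod_cast hL), h.2⟩

lemma boxPast_subset_obsPast (a b k v : ℤ) : boxPast a b k v ⊆ obsPast k v := by
  rintro (u | ⟨j, u⟩) h
  · exact h
  · exact h.2

lemma obsPast_subset_fullPast (k v : ℤ) : obsPast k v ⊆ fullPast k v := by
  rintro (u | ⟨j, u⟩) h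
  · trivial
  · exact h

lemma boxPast_mono (a b k : ℤ) {v v' : ℤ} (h : v ≤ v') : boxPast a b k v ⊆ boxPast a b k v' := by
  rintro (u | ⟨j, u⟩) hu
  · exact hu
  · exact ⟨hu.1, hu.2.imp_right fun hu => ⟨hu.1, hu.2.trans_le h⟩⟩

lemma boxPast_add_one {a b v : ℤ} (k : ℤ) (ha : a ≤ v) (hb : v < b) :
    boxPast a b k (v + 1) = insert (Sum.inr (k, v)) (boxPast a b k v) := by
  ext (u | ⟨j, u⟩)
  · simp [boxPast]
  · simp only [boxPast, Set.mem_ofPred_eq, Sum.elim_inr, Set.mem_insert_iff, Sum.inr.injEq,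
      Prod.mk.injEq]
    omega

/-- A row completed at time `k` is the start of the next row, which lets the chain rule telescope
over rows. -/
lemma boxPast_right {a b k : ℤ} (hk : 1 ≤ k) : boxPast a b k b = boxPast a b (k + 1) a := by
  ext (u | ⟨j, u⟩)
  · simp [boxPast]
  · simp only [boxPast, Set.mem_ofPred_eq, Sum.elim_inr]
    omega

variable {Ω : Type*} {m₀ : MeasurableSpace Ω} {μ : Measure Ω} [IsProbabilityMeasure μ]
  {Z : SpaceTime → Ω → ℤˣ}

/-- The initial state on `[-L, m + L)`. -/
def initialTuple (Z : SpaceTime → Ω → ℤˣ) (L m : ℕ) (ω : Ω) (i : Fin (m + 2 * L)) : ℤˣ :=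
  Z (Sum.inl (-L + (i : ℤ))) ω

lemma measurable_initialTuple (hZ : ∀ i, Measurable (Z i)) (L m : ℕ) :
    Measurable (initialTuple Z L m) :=
  measurable_pi_lambda _ fun _ => hZ _

/-- The margins of width `L` on both sides of `[0, m)` make room for the window around every site of
`[0, m)`. -/
lemma fieldSigma_windowPast_le (L m : ℕ) (k v : ℤ) (h0 : 0 ≤ v) (hm : v < m) :
    fieldSigma Z (windowPast L k v) ≤ fieldSigma Z (boxPast (-L) (m + L) k v)
      ⊔ MeasurableSpace.comap (initialTuple Z L m) inferInstance := by
  have e : MeasurableSpace.comap (initialTuple Z L m) inferInstance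
      = fieldSigma Z (Set.range fun i : Fin (m + 2 * L) => Sum.inl (-L + (i : ℤ))) :=
    comap_tuple Z _
  rw [e, ← fieldSigma_union]
  refine fieldSigma_mono Z ?_
  rintro (u | ⟨j, u⟩) h
  · have h' : |u - v| ≤ L := h
    rw [abs_le] at h'
    exact Or.inr ⟨⟨(u + L).toNat, by omega⟩, by simp only [Sum.inl.injEq]; omega⟩
  · have h' : |u - v| ≤ L := h.1
    rw [abs_le] at h'
    exact Or.inl ⟨by constructor <;> dsimp only <;> omega, h.2⟩

variable (hZ : ∀ i, Measurable (Z i))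
  (hshift : ∀ w, IdentDistrib (fun ω i => Z i ω) (fun ω i => Z (spaceShift w i) ω) μ μ)

include hZ hshift

lemma condEntropy_obsPast (k v : ℤ) :
    condEntropy μ (fieldSigma Z (obsPast k v)) (Z (Sum.inr (k, v)))
      = condEntropy μ (fieldSigma Z (obsPast k 0)) (Z (Sum.inr (k, 0))) := by
  have h := condEntropy_field_shift hZ (hshift v) (obsPast k 0) (Sum.inr (k, 0))
  rw [spaceShift_image_obsPast] at h
  simpa [spaceShift] using h

lemma condEntropy_fullPast (k v : ℤ) :
    condEntropy μ (fieldSigma Z (fullPast k v)) (Z (Sum.inr (k, v)))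
      = condEntropy μ (fieldSigma Z (fullPast k 0)) (Z (Sum.inr (k, 0))) := by
  have h := condEntropy_field_shift hZ (hshift v) (fullPast k 0) (Sum.inr (k, 0))
  rw [spaceShift_image_fullPast] at h
  simpa [spaceShift] using h

lemma condEntropy_windowPast (L k v : ℤ) :
    condEntropy μ (fieldSigma Z (windowPast L k v)) (Z (Sum.inr (k, v)))
      = condEntropy μ (fieldSigma Z (windowPast L k 0)) (Z (Sum.inr (k, 0))) := by
  have h := condEntropy_field_shift hZ (hshift v) (windowPast L k 0) (Sum.inr (k, 0))
  rw [spaceShift_image_windowPast] at h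
  simpa [spaceShift] using h

/-- Revealing one more observation lowers the entropy of the initial tuple by their mutual
information. By symmetry this is a difference of entropies of the observation: the first is bounded
below by enlarging the box past to `obsPast`, the second above by shrinking the conditioning to the
window. Translation invariance makes the bound the same at each site. -/
lemma le_condEntropy_initialTuple_sub (L m : ℕ) (k : ℤ) (i : ℕ) (hi : i ≤ m) :
    i * (condEntropy μ (fieldSigma Z (obsPast k 0)) (Z (Sum.inr (k, 0)))
        - condEntropy μ (fieldSigma Z (windowPast L k 0)) (Z (Sum.inr (k, 0))))
      ≤ condEntropy μ (fieldSigma Z (boxPast (-L) (m + L) k 0)) (initialTuple Z L m)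
        - condEntropy μ (fieldSigma Z (boxPast (-L) (m + L) k i)) (initialTuple Z L m) := by
  induction i with
  | zero => simp
  | succ i ih =>
    have ih := ih (by omega)
    have hU := measurable_initialTuple hZ L m
    have hle := fieldSigma_le hZ
    have h1 := condEntropy_sub_comm (μ := μ) (hle (boxPast (-L) (m + L) k i)) hU
      (hZ (Sum.inr (k, i)))
    rw [← fieldSigma_insert, ← boxPast_add_one k (by omega) (by omega)] at h1
    have h2 := condEntropy_anti (μ := μ)
      (fieldSigma_mono Z (boxPast_subset_obsPast (-L) (m + L) k i)) (hle _) (hZ (Sum.inr (k, i)))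
    have h3 := condEntropy_anti (μ := μ)
      (fieldSigma_windowPast_le (Z := Z) L m k i (by omega) (by omega))
      (sup_le (hle _) hU.comap_le) (hZ (Sum.inr (k, i)))
    rw [condEntropy_obsPast hZ hshift] at h2
    rw [condEntropy_windowPast hZ hshift] at h3
    push_cast
    rw [add_mul, one_mul]
    linarith

/-- The observations in the two margins are also revealed, but they can only lower the entropy
further. -/
lemma le_condEntropy_initialTuple_sub_row (L m : ℕ) {k : ℤ} (hk : 1 ≤ k) :
    m * (condEntropy μ (fieldSigma Z (obsPast k 0)) (Z (Sum.inr (k, 0)))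
        - condEntropy μ (fieldSigma Z (windowPast L k 0)) (Z (Sum.inr (k, 0))))
      ≤ condEntropy μ (fieldSigma Z (boxPast (-L) (m + L) k (-L))) (initialTuple Z L m)
        - condEntropy μ (fieldSigma Z (boxPast (-L) (m + L) (k + 1) (-L)))
          (initialTuple Z L m) := by
  have hU := measurable_initialTuple hZ L m
  have h1 := le_condEntropy_initialTuple_sub hZ hshift L m k m le_rfl
  have h2 := condEntropy_anti (μ := μ) (fieldSigma_mono Z
    (boxPast_mono (-L) (m + L) k (show -(L : ℤ) ≤ 0 by omega))) (fieldSigma_le hZ _) hU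
  have h3 := condEntropy_anti (μ := μ) (fieldSigma_mono Z
    (boxPast_mono (-L) (m + L) k (show (m : ℤ) ≤ m + L by omega))) (fieldSigma_le hZ _) hU
  rw [boxPast_right hk] at h3
  linarith

/-- Telescoping over the rows: the total decrease cannot exceed the entropy of `m + 2L` binary
variables. -/
lemma mul_sum_le (L m n : ℕ) :
    m * ∑ j ∈ Finset.range n,
        (condEntropy μ (fieldSigma Z (obsPast (j + 1) 0)) (Z (Sum.inr (j + 1, 0)))
        - condEntropy μ (fieldSigma Z (windowPast L (j + 1) 0)) (Z (Sum.inr (j + 1, 0))))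
      ≤ (m + 2 * L) * Real.log 2 := by
  have hU := measurable_initialTuple hZ L m
  have h : ∀ n : ℕ, m * ∑ j ∈ Finset.range n,
        (condEntropy μ (fieldSigma Z (obsPast (j + 1) 0)) (Z (Sum.inr (j + 1, 0)))
        - condEntropy μ (fieldSigma Z (windowPast L (j + 1) 0)) (Z (Sum.inr (j + 1, 0))))
      ≤ condEntropy μ (fieldSigma Z (boxPast (-L) (m + L) 1 (-L))) (initialTuple Z L m)
        - condEntropy μ (fieldSigma Z (boxPast (-L) (m + L) (n + 1) (-L)))
          (initialTuple Z L m) := by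
    intro n
    induction n with
    | zero => simp
    | succ n ih =>
      rw [Finset.sum_range_succ, mul_add]
      have := le_condEntropy_initialTuple_sub_row hZ hshift L m (k := n + 1) (by omega)
      push_cast
      linarith
  have h1 := condEntropy_nonneg (μ := μ)
    (fieldSigma_le hZ (boxPast (-L) (m + L) (n + 1) (-L))) hU
  have h2 := condEntropy_le_log_card (μ := μ)
    (fieldSigma_le hZ (boxPast (-L) (m + L) 1 (-L))) hU
  have h3 : Real.log (Fintype.card (Fin (m + 2 * L) → ℤˣ)) = (m + 2 * L) * Real.log 2 := by
    rw [Fintype.card_fun, Fintype.card_units_int, Fintype.card_fin]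
    push_cast
    rw [Real.log_pow]
    push_cast
    rfl
  linarith [h n]

/-- Divide `mul_sum_le` by `m` and let `m → ∞` with `L` and `n` fixed; the boundary contribution `2L
log 2` disappears. -/
lemma sum_window_le (L n : ℕ) :
    ∑ j ∈ Finset.range n,
        (condEntropy μ (fieldSigma Z (obsPast (j + 1) 0)) (Z (Sum.inr (j + 1, 0)))
        - condEntropy μ (fieldSigma Z (windowPast L (j + 1) 0)) (Z (Sum.inr (j + 1, 0))))
      ≤ Real.log 2 := by
  by_contra! hlt
  obtain ⟨m, hm⟩ := exists_nat_gt (2 * L * Real.log 2 / (∑ j ∈ Finset.range n,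
        (condEntropy μ (fieldSigma Z (obsPast (j + 1) 0)) (Z (Sum.inr (j + 1, 0)))
        - condEntropy μ (fieldSigma Z (windowPast L (j + 1) 0)) (Z (Sum.inr (j + 1, 0))))
        - Real.log 2))
  rw [div_lt_iff₀ (by linarith)] at hm
  linarith [mul_sum_le hZ hshift L m n]

/-- Let `L → ∞` in `sum_window_le`: the windows increase to the full past, and the bound does not
depend on `L`. -/
lemma sum_condEntropy_sub_le (n : ℕ) :
    ∑ j ∈ Finset.range n,
        (condEntropy μ (fieldSigma Z (obsPast (j + 1) 0)) (Z (Sum.inr (j + 1, 0)))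
        - condEntropy μ (fieldSigma Z (fullPast (j + 1) 0)) (Z (Sum.inr (j + 1, 0))))
      ≤ Real.log 2 := by
  refine le_of_tendsto' (x := atTop) (tendsto_finsetSum _ fun j _ => tendsto_const_nhds.sub ?_)
    fun L => sum_window_le hZ hshift L n
  rw [← iUnion_windowPast, fieldSigma_iUnion]
  exact tendsto_condEntropy _ (fun L L' h => fieldSigma_mono Z (windowPast_mono _ _ h))
    (fun L => fieldSigma_le hZ _) (hZ _)

/-- The information about the observation at time `k` and site `v` that the initial state carries
in addition to the previous observations vanishes as `k → ∞`. -/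
lemma tendsto_condEntropy_obsPast_sub (v : ℤ) :
    Tendsto (fun k : ℕ =>
      condEntropy μ (fieldSigma Z (obsPast k v)) (Z (Sum.inr ((k : ℤ), v)))
        - condEntropy μ (fieldSigma Z (fullPast k v)) (Z (Sum.inr ((k : ℤ), v))))
      atTop (𝓝 0) := by
  simp only [condEntropy_obsPast hZ hshift _ v, condEntropy_fullPast hZ hshift _ v]
  -- Observation times start at `1`, so the summand with index `j` belongs to time `j + 1`.
  rw [← tendsto_add_atTop_iff_nat 1]
  push_cast
  exact (summable_of_sum_range_le (fun j => sub_nonneg.2 (condEntropy_anti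
    (fieldSigma_mono Z (obsPast_subset_fullPast _ _)) (fieldSigma_le hZ _) (hZ _)))
    (sum_condEntropy_sub_le hZ hshift)).tendsto_atTop_zero

end SpaceTime

/-! ### The `L¹` gap between conditional expectations -/

section CondGap

variable {Ω α : Type*} {F G m₀ : MeasurableSpace Ω}

/-- The `L¹` distance between the conditional expectations of `f` given `F` and given `G`. -/
noncomputable def condGap {m₀ : MeasurableSpace Ω} (μ : Measure Ω) (F G : MeasurableSpace Ω)
    (f : Ω → ℝ) : ℝ :=
  ∫ ω, |(μ[f | F]) ω - (μ[f | G]) ω| ∂μ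

variable {μ : Measure Ω}

lemma condGap_nonneg (f : Ω → ℝ) : 0 ≤ condGap μ F G f :=
  integral_nonneg fun _ => abs_nonneg _

lemma integrable_condGap (f : Ω → ℝ) :
    Integrable (fun ω => |(μ[f | F]) ω - (μ[f | G]) ω|) μ :=
  (integrable_condExp.sub integrable_condExp).abs

lemma condGap_add_le {f g : Ω → ℝ} (hf : Integrable f μ) (hg : Integrable g μ) :
    condGap μ F G (fun ω => f ω + g ω) ≤ condGap μ F G f + condGap μ F G g := by
  unfold condGap
  rw [← integral_add (integrable_condGap f) (integrable_condGap g)]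
  refine integral_mono_ae (integrable_condGap _)
    ((integrable_condGap f).add (integrable_condGap g)) ?_
  filter_upwards [condExp_add hf hg F, condExp_add hf hg G] with ω h1 h2
  change |(μ[f + g | F]) ω - (μ[f + g | G]) ω| ≤ _
  rw [h1, h2, Pi.add_apply, Pi.add_apply, add_sub_add_comm]
  exact abs_add_le _ _

lemma condGap_of_condExp_eq {f g : Ω → ℝ} {c : ℝ}
    (hF : μ[f | F] =ᵐ[μ] fun ω => c * (μ[g | F]) ω)
    (hG : μ[f | G] =ᵐ[μ] fun ω => c * (μ[g | G]) ω) :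
    condGap μ F G f = |c| * condGap μ F G g := by
  unfold condGap
  rw [← integral_const_mul]
  refine integral_congr_ae ?_
  filter_upwards [hF, hG] with ω h1 h2
  rw [h1, h2, ← mul_sub, abs_mul]

lemma condGap_const_mul (c : ℝ) (f : Ω → ℝ) :
    condGap μ F G (fun ω => c * f ω) = |c| * condGap μ F G f :=
  condGap_of_condExp_eq (condExp_smul c f F) (condExp_smul c f G)

/-- Both conditional expectations contract `L¹`, hence the factor `2`. This allows approximation
uniformly in the σ-algebras. -/
lemma condGap_le_add {f g : Ω → ℝ} (hf : Integrable f μ) (hg : Integrable g μ) :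
    condGap μ F G f ≤ condGap μ F G g + 2 * ∫ ω, |f ω - g ω| ∂μ := by
  have h1 : condGap μ F G f ≤ condGap μ F G g + condGap μ F G (fun ω => f ω - g ω) := by
    have := condGap_add_le (F := F) (G := G) hg (hf.sub hg)
    simpa using! this
  have h2 : condGap μ F G (fun ω => f ω - g ω) ≤ 2 * ∫ ω, |f ω - g ω| ∂μ := by
    have hF := integral_abs_condExp_le (m := F) (μ := μ) fun ω => f ω - g ω
    have hG := integral_abs_condExp_le (m := G) (μ := μ) fun ω => f ω - g ω
    have : condGap μ F G (fun ω => f ω - g ω) ≤ ∫ ω, |(μ[fun ω => f ω - g ω | F]) ω| ∂μ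
        + ∫ ω, |(μ[fun ω => f ω - g ω | G]) ω| ∂μ := by
      rw [← integral_add integrable_condExp.abs integrable_condExp.abs]
      exact integral_mono (integrable_condGap _)
        (integrable_condExp.abs.add integrable_condExp.abs) fun ω => abs_sub _ _
    linarith
  linarith

variable [IsProbabilityMeasure μ]

/-- Conditioning additionally on a discrete random variable `V` increases the distance between
conditional expectations in a controlled way. -/
lemma condGap_sup_comap_le [Fintype α] [MeasurableSpace α] [MeasurableSingletonClass α]
    (hF : F ≤ m₀) (hG : G ≤ F) {V : Ω → α} (hV : Measurable V) {f : Ω → ℝ}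
    (hf : Integrable f μ) {C : ℝ} (hC : 0 ≤ C) (hb : ∀ ω, |f ω| ≤ C) :
    condGap μ (F ⊔ MeasurableSpace.comap V inferInstance)
        (G ⊔ MeasurableSpace.comap V inferInstance) f
      ≤ ∑ a, (condGap μ F G ((V ⁻¹' {a}).indicator f)
        + C * condGap μ F G ((V ⁻¹' {a}).indicator fun _ => 1)) := by
  have hE := fun a => hV (measurableSet_singleton a)
  have hint := integrable_condGap (μ := μ) (F := F ⊔ MeasurableSpace.comap V inferInstance)
    (G := G ⊔ MeasurableSpace.comap V inferInstance) f
  have e : condGap μ (F ⊔ MeasurableSpace.comap V inferInstance)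
        (G ⊔ MeasurableSpace.comap V inferInstance) f
      = ∑ a, ∫ ω, (V ⁻¹' {a}).indicator (fun ω =>
        |(μ[f | F ⊔ MeasurableSpace.comap V inferInstance]) ω
          - (μ[f | G ⊔ MeasurableSpace.comap V inferInstance]) ω|) ω ∂μ := by
    rw [← integral_finsetSum _ fun a _ => hint.indicator (hE a)]
    unfold condGap
    congr 1
    ext ω
    rw [← Finset.sum_apply, sum_indicator_preimage_singleton]
  rw [e]
  refine Finset.sum_le_sum fun a _ => ?_
  obtain ⟨g, hgm, hgb, hgV, hgE⟩ := exists_condExp_sup_comap hF hV a hf hC hb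
  obtain ⟨h, hhm, hhb, hhV, hhE⟩ := exists_condExp_sup_comap (hG.trans hF) hV a hf hC hb
  have hdm : Measurable[F] fun ω => |g ω - h ω| := 
    continuous_abs.measurable.comp (hgm.sub (hhm.mono hG le_rfl))
  have hdb : ∀ ω, |(|g ω - h ω|)| ≤ C + C := fun ω => by
    rw [abs_abs]
    exact (abs_sub _ _).trans (add_le_add (hgb ω) (hhb ω))
  calc ∫ ω, (V ⁻¹' {a}).indicator (fun ω =>
        |(μ[f | F ⊔ MeasurableSpace.comap V inferInstance]) ω
          - (μ[f | G ⊔ MeasurableSpace.comap V inferInstance]) ω|) ω ∂μ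
      = ∫ ω, (V ⁻¹' {a}).indicator (fun _ => (1 : ℝ)) ω * |g ω - h ω| ∂μ := by
        rw [indicator_one_mul]
        refine integral_congr_ae ?_
        filter_upwards [hgV, hhV] with ω h1 h2
        by_cases hω : V ω = a
        · simp only [Set.indicator_of_mem (show ω ∈ V ⁻¹' {a} from hω), h1 hω, h2 hω]
        · simp only [Set.indicator_of_notMem (show ω ∉ V ⁻¹' {a} from hω)]
    -- As `|g - h|` is `F`-measurable, the indicator may be replaced by its conditional probability.
    _ = ∫ ω, (μ⟦V ⁻¹' {a} | F⟧) ω * |g ω - h ω| ∂μ :=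
        (integral_mul_condExp hF (integrable_indicator_one (hE a)) hdm hdb).symm
    _ ≤ ∫ ω, (|(μ[(V ⁻¹' {a}).indicator f | F]) ω - (μ[(V ⁻¹' {a}).indicator f | G]) ω|
        + C * |(μ⟦V ⁻¹' {a} | F⟧) ω - (μ⟦V ⁻¹' {a} | G⟧) ω|) ∂μ := by
        refine integral_mono_ae ?_ ((integrable_condGap _).add ((integrable_condGap _).const_mul C))
          ?_
        · refine integrable_of_measurable_of_bound (C := C + C) hF
            (stronglyMeasurable_condExp.measurable.mul hdm) ?_
          filter_upwards [ae_condProb_mem_Icc (hE a) hF] with ω h1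
          rw [abs_mul, abs_of_nonneg h1.1]
          have := hdb ω
          nlinarith [h1.1, h1.2, abs_nonneg (|g ω - h ω|)]
        · filter_upwards [hgE, hhE, ae_condProb_mem_Icc (hE a) hF] with ω h1 h2 h3
          rw [h1, h2]
          set b := (μ⟦V ⁻¹' {a} | F⟧) ω
          set b' := (μ⟦V ⁻¹' {a} | G⟧) ω
          calc b * |g ω - h ω| = |b * (g ω - h ω)| := by rw [abs_mul, abs_of_nonneg h3.1]
            -- Only `g * b` and `h * b'` are conditional expectations given `F` and `G`; this avoids
            -- dividing by `b` or `b'`, which may be small.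
            _ = |(g ω * b - h ω * b') + h ω * (b' - b)| := by congr 1; ring
            _ ≤ |g ω * b - h ω * b'| + |h ω| * |b' - b| := by
              rw [← abs_mul]; exact abs_add_le _ _
            _ ≤ |g ω * b - h ω * b'| + C * |b - b'| := by
              rw [abs_sub_comm b' b]
              have := hhb ω
              gcongr
    _ = _ := by
        rw [integral_add (integrable_condGap _) ((integrable_condGap _).const_mul C),
          integral_const_mul]
        rfl

/-- The `L¹` norm is at most the `L²` norm (nonnegativity of the variance), and the latter is
controlled by `integral_sq_condProb_sub_le`. -/
lemma condGap_indicator_sq_le [Fintype α] [MeasurableSpace α] [MeasurableSingletonClass α]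
    (hF : F ≤ m₀) (hG : G ≤ F) {W : Ω → α} (hW : Measurable W) (w : α) :
    condGap μ F G ((W ⁻¹' {w}).indicator fun _ => 1) ^ 2
      ≤ 2 * (condEntropy μ G W - condEntropy μ F W) := by
  have h := integral_sq_condProb_sub_le (μ := μ) hG hF hW w
  have hE := hW (measurableSet_singleton w)
  have hd : Measurable[F] fun ω => |(μ⟦W ⁻¹' {w} | F⟧) ω - (μ⟦W ⁻¹' {w} | G⟧) ω| :=
    continuous_abs.measurable.comp (stronglyMeasurable_condExp.measurable.sub
      (stronglyMeasurable_condExp.measurable.mono hG le_rfl))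
  have hmem : MemLp (fun ω => |(μ⟦W ⁻¹' {w} | F⟧) ω - (μ⟦W ⁻¹' {w} | G⟧) ω|) 2 μ := by
    refine MemLp.of_bound (hd.mono hF le_rfl).aestronglyMeasurable 1 ?_
    filter_upwards [ae_condProb_mem_Icc hE hF, ae_condProb_mem_Icc hE (hG.trans hF)] with ω h1 h2
    rw [Real.norm_eq_abs, abs_abs, abs_le]
    constructor <;> linarith [h1.1, h1.2, h2.1, h2.2]
  have hv := variance_nonneg (fun ω => |(μ⟦W ⁻¹' {w} | F⟧) ω - (μ⟦W ⁻¹' {w} | G⟧) ω|) μ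
  rw [variance_eq_sub hmem] at hv
  simp only [Pi.pow_apply, sq_abs] at hv
  unfold condGap
  linarith

end CondGap

/-! ### Functions of finitely many spins -/

section SiteFunctions

/-- The product of the spins at the sites in `J`. -/
def siteProd (J : Finset ℤ) (x : Conf) : ℝ := ∏ u ∈ J, ((x u : ℤ) : ℝ)

lemma siteProd_mul (J : Finset ℤ) (x y : Conf) :
    siteProd J (fun u => x u * y u) = siteProd J x * siteProd J y := by
  simp [siteProd, Finset.prod_mul_distrib]

lemma dependsOn_siteProd (J : Finset ℤ) : DependsOn (siteProd J) J := fun x y h =>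
  Finset.prod_congr rfl fun u hu => by rw [h u hu]

/-- Every function of finitely many spins is a linear combination of products of spins. -/
lemma dependsOn_induction {P : (Conf → ℝ) → Prop}
    (hadd : ∀ f g, P f → P g → P fun x => f x + g x) (hmul : ∀ c f, P f → P fun x => c * f x)
    (K : Finset ℤ) (hK : ∀ J ⊆ K, P (siteProd J)) {f : Conf → ℝ} (hf : DependsOn f K) : P f := by
  -- `I` holds the spins on which `f` may still depend, `J` those already extracted. One spin is
  -- moved at a time by `f = (f₊ + f₋)/2 + x_u (f₊ - f₋)/2`, where `f₊` and `f₋` fix `x_u` to `1`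
  -- and `-1`.
  have key : ∀ I J : Finset ℤ, Disjoint I J → I ∪ J ⊆ K → ∀ f : Conf → ℝ, DependsOn f I →
      P fun x => f x * siteProd J x := by
    intro I
    induction I using Finset.induction_on with
    | empty =>
      intro J _ hJ f hf
      have e : (fun x => f x * siteProd J x) = fun x => f 1 * siteProd J x := by
        ext x
        rw [hf (x := x) (y := 1) (by simp)]
      rw [e]
      exact hmul _ _ (hK J (by simpa using hJ))
    | insert u I hu ih =>
      intro J hd hIJ f hf
      rw [Finset.disjoint_insert_left] at hd
      have hdep : ∀ s : ℤˣ, DependsOn (fun x => f (Function.update x u s)) I := by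
        intro s x y hxy
        refine hf fun w hw => ?_
        by_cases hwu : w = u
        · subst hwu; simp
        · rw [Function.update_of_ne hwu, Function.update_of_ne hwu]
          exact hxy w (by simpa [hwu] using hw)
      have h1 := ih J hd.2 ((Finset.union_subset_union_left (Finset.subset_insert _ _)).trans hIJ)
        (fun x => (f (Function.update x u 1) + f (Function.update x u (-1))) / 2)
        fun x y hxy => by
          have e1 := hdep 1 hxy
          have e2 := hdep (-1) hxy
          dsimp only at e1 e2 ⊢
          rw [e1, e2]
      have h2 := ih (insert u J) (by simp [hu, hd.2])
        (by rw [Finset.union_insert, ← Finset.insert_union]; exact hIJ)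
        (fun x => (f (Function.update x u 1) - f (Function.update x u (-1))) / 2)
        fun x y hxy => by
          have e1 := hdep 1 hxy
          have e2 := hdep (-1) hxy
          dsimp only at e1 e2 ⊢
          rw [e1, e2]
      convert hadd _ _ h1 h2 using 2 with x
      have e : siteProd (insert u J) x = ((x u : ℤ) : ℝ) * siteProd J x :=
        Finset.prod_insert hd.1
      rw [e]
      have hx : f x = f (Function.update x u (x u)) := by rw [Function.update_eq_self]
      rcases Int.units_eq_one_or (x u) with h | h
      · rw [hx, h]; push_cast; ring
      · rw [hx, h]; push_cast; ring
  have h := key K ∅ (by simp) (by simp) f hf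
  simpa [siteProd] using h

lemma measurable_of_dependsOn {K : Finset ℤ} {f : Conf → ℝ} (hf : DependsOn f K) :
    Measurable f := by
  refine dependsOn_induction (P := Measurable) (fun f g hf hg => hf.add hg)
    (fun c f hf => hf.const_mul c) K (fun J _ => ?_) hf
  exact Finset.measurable_fun_prod _ fun u _ =>
    (measurable_of_countable fun s : ℤˣ => ((s : ℤ) : ℝ)).comp (measurable_pi_apply u)

lemma abs_siteProd (J : Finset ℤ) (x : Conf) : |siteProd J x| = 1 := by
  rw [siteProd, Finset.abs_prod]
  refine Finset.prod_eq_one fun u _ => ?_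
  rcases Int.units_eq_one_or (x u) with h | h <;> simp [h]

lemma exists_bound_of_dependsOn {K : Finset ℤ} {f : Conf → ℝ} (hf : DependsOn f K) :
    ∃ C, ∀ x, |f x| ≤ C := by
  refine dependsOn_induction (P := fun f => ∃ C, ∀ x, |f x| ≤ C) ?_ ?_ K ?_ hf
  · rintro f g ⟨C, hC⟩ ⟨D, hD⟩
    exact ⟨C + D, fun x => (abs_add_le _ _).trans (add_le_add (hC x) (hD x))⟩
  · rintro c f ⟨C, hC⟩
    exact ⟨|c| * C, fun x => by rw [abs_mul]; exact mul_le_mul_of_nonneg_left (hC x) (abs_nonneg c)⟩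
  · exact fun J _ => ⟨1, fun x => (abs_siteProd J x).le⟩

lemma measurable_siteProd (J : Finset ℤ) : Measurable (siteProd J) :=
  measurable_of_dependsOn (dependsOn_siteProd J)

end SiteFunctions

/-! ### Integrating out the observation noise -/

section Noise

variable {Ω : Type*} {A B C H m₀ : MeasurableSpace Ω} {μ : Measure Ω}

variable {X Y ξ : ℤ → Ω → Conf} {p : ℝ}

/-- The σ-algebra generated by the states and by all the noise variables except those at time `k`
and at the sites `w ≥ v`. -/
@[reducible] def restSigma (X ξ : ℤ → Ω → Conf) (k v : ℤ) : MeasurableSpace Ω :=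
  fieldSigma (fun (q : ℤ × ℤ) ω => ξ q.1 ω q.2) {q | q.1 = k ∧ v ≤ q.2}ᶜ
    ⊔ MeasurableSpace.comap (fun ω k => X k ω) inferInstance

lemma IsDirectObservation.measurable_noise_apply (hobs : IsDirectObservation μ p X Y ξ)
    (q : ℤ × ℤ) : Measurable fun ω => ξ q.1 ω q.2 :=
  (measurable_pi_apply q.2).comp (hobs.measurable_noise q.1)

lemma restSigma_le (hobs : IsDirectObservation μ p X Y ξ) (hX : ∀ k, Measurable (X k))
    (k v : ℤ) : restSigma X ξ k v ≤ m₀ :=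
  sup_le (fieldSigma_le hobs.measurable_noise_apply _) (measurable_pi_lambda _ hX).comap_le

variable [IsProbabilityMeasure μ]

lemma indep_sup_right_of_indep (hA : A ≤ m₀) (hB : B ≤ m₀) (hC : C ≤ m₀) (hAB : Indep A B μ)
    (hABC : Indep (A ⊔ B) C μ) : Indep A (B ⊔ C) μ := by
  refine IndepSets.indep (p1 := {s | MeasurableSet[A] s})
    (p2 := {s | ∃ b c, MeasurableSet[B] b ∧ MeasurableSet[C] c ∧ s = b ∩ c}) hA (sup_le hB hC)
    (@MeasurableSpace.isPiSystem_measurableSet _ A) ?_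
    (@MeasurableSpace.generateFrom_measurableSet _ A).symm ?_ ?_
  · rintro _ ⟨b, c, hb, hc, rfl⟩ _ ⟨b', c', hb', hc', rfl⟩ _
    exact ⟨b ∩ b', c ∩ c', hb.inter hb', hc.inter hc', Set.inter_inter_inter_comm ..⟩
  · refine le_antisymm (sup_le ?_ ?_) (MeasurableSpace.generateFrom_le ?_)
    · exact fun b hb => MeasurableSpace.measurableSet_generateFrom
        ⟨b, Set.univ, hb, MeasurableSet.univ, by simp⟩
    · exact fun c hc => MeasurableSpace.measurableSet_generateFrom
        ⟨Set.univ, c, MeasurableSet.univ, hc, by simp⟩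
    · rintro _ ⟨b, c, hb, hc, rfl⟩
      exact MeasurableSet.inter ((le_sup_left : B ≤ B ⊔ C) _ hb) ((le_sup_right : C ≤ B ⊔ C) _ hc)
  · rw [Indep_iff] at hAB hABC
    rw [IndepSets_iff]
    rintro a _ ha ⟨b, c, hb, hc, rfl⟩
    have ha' : MeasurableSet[A ⊔ B] a := (le_sup_left : A ≤ A ⊔ B) _ ha
    have hb' : MeasurableSet[A ⊔ B] b := (le_sup_right : B ≤ A ⊔ B) _ hb
    rw [← Set.inter_assoc, hABC _ _ (ha'.inter hb') hc, hABC _ _ hb' hc, hAB _ _ ha hb, mul_assoc]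

/-- The two blocks of noise are independent, and jointly they are independent of the states, so the
first block is independent of the second together with the states. -/
lemma indep_noise_restSigma (hobs : IsDirectObservation μ p X Y ξ) (hX : ∀ k, Measurable (X k))
    (k v : ℤ) : Indep (fieldSigma (fun (q : ℤ × ℤ) ω => ξ q.1 ω q.2) {q | q.1 = k ∧ v ≤ q.2})
      (restSigma X ξ k v) μ := by
  have hle := fieldSigma_le hobs.measurable_noise_apply
  refine indep_sup_right_of_indep (hle _) (hle _) (measurable_pi_lambda _ hX).comap_le
    (indep_iSup_of_disjoint (fun q => (hobs.measurable_noise_apply q).comap_le)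
      hobs.noise_indep disjoint_compl_right) ?_
  refine indep_of_indep_of_le_left hobs.noise_indep_state ?_
  rw [← fieldSigma_union]
  refine iSup₂_le fun q _ => ?_
  have h : Measurable fun x : ℤ → Conf => x q.1 q.2 :=
    (measurable_pi_apply q.2).comp (measurable_pi_apply q.1)
  change MeasurableSpace.comap ((fun x : ℤ → Conf => x q.1 q.2) ∘ fun ω k => ξ k ω) _ ≤ _
  rw [← MeasurableSpace.comap_comp]
  exact MeasurableSpace.comap_mono h.comap_le

lemma integral_noise (hobs : IsDirectObservation μ p X Y ξ) (k v : ℤ) :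
    ∫ ω, ((ξ k ω v : ℤ) : ℝ) ∂μ = 1 - 2 * p := by
  have hE : MeasurableSet {ω | ξ k ω v = -1} :=
    hobs.measurable_noise_apply (k, v) (measurableSet_singleton (-1))
  have e : ∀ ω, ((ξ k ω v : ℤ) : ℝ)
      = 1 - 2 * {ω | ξ k ω v = -1}.indicator (fun _ => (1 : ℝ)) ω := fun ω => by
    rcases Int.units_eq_one_or (ξ k ω v) with h | h
    · have : ω ∉ {ω | ξ k ω v = -1} := by simp [h]
      rw [Set.indicator_of_notMem this, h]; simp
    · have : ω ∈ {ω | ξ k ω v = -1} := h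
      rw [Set.indicator_of_mem this, h]; norm_num
  simp only [e]
  rw [integral_sub (integrable_const 1) ((integrable_indicator_one hE).const_mul 2),
    integral_const_mul, integral_indicator_const _ hE, hobs.noise_prob k v]
  simp

lemma integral_siteProd_noise (hobs : IsDirectObservation μ p X Y ξ) (k : ℤ) (T : Finset ℤ) :
    ∫ ω, siteProd T (ξ k ω) ∂μ = (1 - 2 * p) ^ T.card := by
  have hind : iIndepFun (fun (u : T) ω => ((ξ k ω u : ℤ) : ℝ)) μ :=
    (hobs.noise_indep.precomp (g := fun u : T => (k, (u : ℤ)))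
      (fun a b h => Subtype.ext (Prod.ext_iff.1 h).2)).comp
      (fun _ (s : ℤˣ) => ((s : ℤ) : ℝ)) fun _ => measurable_of_countable _
  have h := hind.integral_fun_prod_eq_prod_integral fun u =>
    ((measurable_of_countable fun s : ℤˣ => ((s : ℤ) : ℝ)).comp
      (hobs.measurable_noise_apply (k, (u : ℤ)))).aestronglyMeasurable
  simp only [integral_noise hobs, Finset.prod_const, Finset.card_univ, Fintype.card_coe] at h
  rw [← h]
  refine integral_congr_ae (ae_of_all _ fun ω => ?_)
  exact (Finset.prod_coe_sort T fun u => ((ξ k ω u : ℤ) : ℝ)).symm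

/-- Noise at time `k` and sites `≥ v` integrates out of conditional expectations. -/
lemma condExp_mul_siteProd_noise (hobs : IsDirectObservation μ p X Y ξ)
    (hX : ∀ k, Measurable (X k)) {k v : ℤ} (hH : H ≤ restSigma X ξ k v)
    {f : Conf → ℝ} (hf : Measurable f) {C : ℝ} (hC : ∀ x, |f x| ≤ C) {T : Finset ℤ}
    (hT : ∀ u ∈ T, v ≤ u) :
    μ[fun ω => f (X k ω) * siteProd T (ξ k ω) | H]
      =ᵐ[μ] fun ω => (1 - 2 * p) ^ T.card * (μ[fun ω => f (X k ω) | H]) ω := by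
  have hR := restSigma_le hobs hX k v
  have hξm : Measurable fun ω => siteProd T (ξ k ω) :=
    (measurable_siteProd T).comp (hobs.measurable_noise k)
  have hξi : Integrable (fun ω => siteProd T (ξ k ω)) μ :=
    Integrable.of_bound hξm.aestronglyMeasurable 1 (ae_of_all _ fun ω => (abs_siteProd T _).le)
  have hξs : Measurable[fieldSigma (fun (q : ℤ × ℤ) ω => ξ q.1 ω q.2) {q | q.1 = k ∧ v ≤ q.2}]
      fun ω => siteProd T (ξ k ω) := by
    refine Finset.measurable_fun_prod _ fun u hu => ?_
    exact (measurable_of_countable fun s : ℤˣ => ((s : ℤ) : ℝ)).comp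
      (measurable_fieldSigma (fun (q : ℤ × ℤ) ω => ξ q.1 ω q.2) (i := (k, u)) ⟨rfl, hT u hu⟩)
  have hXs : Measurable[restSigma X ξ k v] fun ω => f (X k ω) := by
    refine Measurable.mono (ma := MeasurableSpace.comap (fun ω k => X k ω) inferInstance) ?_
      le_sup_right le_rfl
    have hc : Measurable fun x : ℤ → Conf => f (x k) := hf.comp (measurable_pi_apply k)
    exact hc.comp (comap_measurable fun ω k => X k ω)
  have h1 : μ[fun ω => f (X k ω) * siteProd T (ξ k ω) | restSigma X ξ k v]
      =ᵐ[μ] (1 - 2 * p) ^ T.card • fun ω => f (X k ω) := by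
    have h2 := condExp_stronglyMeasurable_mul_of_bound hR hXs.stronglyMeasurable hξi C
      (ae_of_all _ fun ω => hC _)
    have h3 := condExp_indep_eq (fieldSigma_le hobs.measurable_noise_apply _) hR
      hξs.stronglyMeasurable (indep_noise_restSigma hobs hX k v)
    rw [integral_siteProd_noise hobs] at h3
    refine h2.trans ?_
    filter_upwards [h3] with ω h
    rw [Pi.mul_apply, h, Pi.smul_apply, smul_eq_mul, mul_comm]
  exact (condExp_condExp_of_le hH hR).symm.trans ((condExp_congr_ae h1).trans (condExp_smul _ _ H))

end Noise

/-! ### Linear structure of sequences with vanishing gap -/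

section VanishingCondGap

variable {Ω κ : Type*} {m₀ : MeasurableSpace Ω}

/-- The conditional expectations of `f k` given `F k` and given `G k` are asymptotically the same
in `L¹`. -/
def VanishingCondGap {m₀ : MeasurableSpace Ω} (μ : Measure Ω) (F G : ℕ → MeasurableSpace Ω)
    (f : ℕ → Ω → ℝ) : Prop :=
  (∀ k, Integrable (f k) μ) ∧ Tendsto (fun k => condGap μ (F k) (G k) (f k)) atTop (𝓝 0)

variable {μ : Measure Ω} {F G : ℕ → MeasurableSpace Ω} {f g : ℕ → Ω → ℝ}

lemma VanishingCondGap.add (hf : VanishingCondGap μ F G f) (hg : VanishingCondGap μ F G g) :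
    VanishingCondGap μ F G fun k ω => f k ω + g k ω := by
  refine ⟨fun k => (hf.1 k).add (hg.1 k), ?_⟩
  have h := hf.2.add hg.2
  rw [add_zero] at h
  exact squeeze_zero (fun _ => condGap_nonneg _) (fun k => condGap_add_le (hf.1 k) (hg.1 k)) h

lemma VanishingCondGap.const_mul (c : ℝ) (hf : VanishingCondGap μ F G f) :
    VanishingCondGap μ F G fun k ω => c * f k ω := by
  refine ⟨fun k => (hf.1 k).const_mul c, ?_⟩
  simp only [condGap_const_mul]
  simpa using hf.2.const_mul |c|

lemma VanishingCondGap.sum {s : Finset κ} {f : κ → ℕ → Ω → ℝ}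
    (hf : ∀ i ∈ s, VanishingCondGap μ F G (f i)) :
    VanishingCondGap μ F G fun k ω => ∑ i ∈ s, f i k ω := by
  classical
  induction s using Finset.induction_on with
  | empty =>
    refine ⟨fun k => by simp, ?_⟩
    have h : ∀ k, condGap μ (F k) (G k) (fun _ => 0) = 0 := fun k => by
      simpa using condGap_const_mul (μ := μ) (F := F k) (G := G k) 0 fun _ => 0
    simp [h]
  | insert i s hi ih =>
    simp only [Finset.sum_insert hi]
    exact (hf i (Finset.mem_insert_self i s)).add
      (ih fun j hj => hf j (Finset.mem_insert_of_mem hj))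

end VanishingCondGap

/-! ### From one observation to a finite block of observations -/

section ObservationTuple

variable {Ω : Type*} {m m₀ : MeasurableSpace Ω} {μ : Measure Ω} {Z : SpaceTime → Ω → ℤˣ}

/-- The observations at time `k` on `[v, v + r)`. -/
def obsTuple (Z : SpaceTime → Ω → ℤˣ) (k v : ℤ) (r : ℕ) (ω : Ω) (i : Fin r) : ℤˣ :=
  Z (Sum.inr (k, v + (i : ℤ))) ω

lemma measurable_obsTuple (hZ : ∀ i, Measurable (Z i)) (k v : ℤ) (r : ℕ) :
    Measurable (obsTuple Z k v r) :=
  measurable_pi_lambda _ fun _ => hZ _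

lemma fieldSigma_obsPast_sup (k v : ℤ) (r : ℕ) :
    fieldSigma Z (obsPast k v) ⊔ MeasurableSpace.comap (obsTuple Z k v r) inferInstance
      = fieldSigma Z (obsPast k (v + r)) := by
  have e : MeasurableSpace.comap (obsTuple Z k v r) inferInstance
      = fieldSigma Z (Set.range fun i : Fin r => Sum.inr (k, v + (i : ℤ))) := comap_tuple Z _
  rw [e, ← fieldSigma_union]
  congr 1
  ext (u | ⟨j, u⟩)
  · simp [obsPast]
  · simp only [obsPast, Set.mem_union, Set.mem_ofPred_eq, Sum.elim_inr, Set.mem_range,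
      Sum.inr.injEq, Prod.mk.injEq]
    refine ⟨?_, fun h => ?_⟩
    · rintro (h | ⟨i, h⟩) <;> omega
    · by_cases hu : j = k ∧ v ≤ u ∧ u < v + r
      · exact Or.inr ⟨⟨(u - v).toNat, by omega⟩, by simp only; omega⟩
      · exact Or.inl (by omega)

lemma fullPast_eq_union (k v : ℤ) : fullPast k v = Set.range Sum.inl ∪ obsPast k v := by
  ext (u | ⟨j, u⟩) <;> simp [fullPast, obsPast]

lemma fieldSigma_fullPast (k v : ℤ) :
    fieldSigma Z (fullPast k v)
      = fieldSigma Z (Set.range Sum.inl) ⊔ fieldSigma Z (obsPast k v) := by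
  rw [fullPast_eq_union, fieldSigma_union]

lemma fieldSigma_fullPast_sup (k v : ℤ) (r : ℕ) :
    fieldSigma Z (fullPast k v) ⊔ MeasurableSpace.comap (obsTuple Z k v r) inferInstance
      = fieldSigma Z (fullPast k (v + r)) := by
  rw [fieldSigma_fullPast, fieldSigma_fullPast, sup_assoc, fieldSigma_obsPast_sup]

variable [IsProbabilityMeasure μ]

lemma condEntropy_obsTuple_succ (hZ : ∀ i, Measurable (Z i)) (hm : m ≤ m₀) (k v : ℤ) (r : ℕ) :
    condEntropy μ m (obsTuple Z k v (r + 1)) = condEntropy μ m (obsTuple Z k v r)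
      + condEntropy μ (m ⊔ MeasurableSpace.comap (obsTuple Z k v r) inferInstance)
        (Z (Sum.inr (k, v + r))) := by
  rw [← condEntropy_prodMk hm (hZ _) (measurable_obsTuple hZ k v r),
    ← condEntropy_equiv (Fin.snocEquiv fun _ => ℤˣ)]
  congr 1
  ext ω i
  refine Fin.lastCases ?_ (fun i => ?_) i <;> simp [obsTuple, Fin.snocEquiv]

/-- By the chain rule the information in a block is a sum of single-site informations: the past at
`v` enlarged by the first `r` observations is the past at `v + r`. -/
lemma tendsto_condEntropy_obsTuple_sub (hZ : ∀ i, Measurable (Z i))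
    (hshift : ∀ w, IdentDistrib (fun ω i => Z i ω) (fun ω i => Z (spaceShift w i) ω) μ μ)
    (v : ℤ) (r : ℕ) :
    Tendsto (fun k : ℕ => condEntropy μ (fieldSigma Z (obsPast k v)) (obsTuple Z k v r)
      - condEntropy μ (fieldSigma Z (fullPast k v)) (obsTuple Z k v r)) atTop (𝓝 0) := by
  induction r with
  | zero =>
    have h : ∀ (k : ℕ) (S : Set SpaceTime),
        condEntropy μ (fieldSigma Z S) (obsTuple Z k v 0) = 0 := fun k S =>
      le_antisymm ((condEntropy_le_log_card (fieldSigma_le hZ S) (measurable_obsTuple hZ k v 0)).trans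
        (by simp))
        (condEntropy_nonneg (fieldSigma_le hZ S) (measurable_obsTuple hZ k v 0))
    simp [h]
  | succ r ih =>
    have h := ih.add (tendsto_condEntropy_obsPast_sub hZ hshift (v + r))
    rw [add_zero] at h
    refine h.congr fun k => ?_
    rw [condEntropy_obsTuple_succ hZ (fieldSigma_le hZ _),
      condEntropy_obsTuple_succ hZ (fieldSigma_le hZ _), fieldSigma_obsPast_sup,
      fieldSigma_fullPast_sup]
    ring

lemma vanishingCondGap_obsTuple (hZ : ∀ i, Measurable (Z i))
    (hshift : ∀ w, IdentDistrib (fun ω i => Z i ω) (fun ω i => Z (spaceShift w i) ω) μ μ)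
    (v : ℤ) (r : ℕ) (φ : (Fin r → ℤˣ) → ℝ) :
    VanishingCondGap μ (fun k => fieldSigma Z (fullPast k v)) (fun k => fieldSigma Z (obsPast k v))
      fun k ω => φ (obsTuple Z k v r ω) := by
  have hW := fun k : ℕ => measurable_obsTuple hZ k v r
  have h : ∀ w, VanishingCondGap μ (fun k => fieldSigma Z (fullPast k v))
      (fun k => fieldSigma Z (obsPast k v))
      fun k => ((obsTuple Z k v r) ⁻¹' {w}).indicator fun _ => 1 := fun w => by
    refine ⟨fun k => integrable_indicator_one (hW k (measurableSet_singleton w)), ?_⟩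
    have h2 := (tendsto_condEntropy_obsTuple_sub hZ hshift v r).const_mul 2
    rw [mul_zero] at h2
    have h3 := (squeeze_zero (fun _ => sq_nonneg _) (fun k : ℕ => condGap_indicator_sq_le
      (fieldSigma_le hZ _) (fieldSigma_mono Z (obsPast_subset_fullPast k v)) (hW k) w) h2).sqrt
    simpa only [Real.sqrt_sq (condGap_nonneg _), Real.sqrt_zero] using h3
  have hsum := VanishingCondGap.sum (s := Finset.univ) fun w _ => (h w).const_mul (φ w)
  convert hsum using 3 with k ω
  rw [Finset.sum_eq_single (obsTuple Z k v r ω)]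
  · simp
  · intro w _ hw
    simp [hw.symm]
  · simp

end ObservationTuple

/-! ### From observations to states, and conclusion -/

section Filtering

variable {Ω : Type*} {m₀ : MeasurableSpace Ω} {μ : Measure Ω} {X Y ξ : ℤ → Ω → Conf} {p : ℝ}

/-- The space-time field consisting of the initial state and of all the observations. -/
def obsField (X Y : ℤ → Ω → Conf) : SpaceTime → Ω → ℤˣ :=
  Sum.elim (fun w ω => X 0 ω w) fun q ω => Y q.1 ω q.2

lemma measurable_obsField (hX : ∀ k, Measurable (X k)) (hY : ∀ k, Measurable (Y k)) :
    ∀ i, Measurable (obsField X Y i)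
  | Sum.inl w => (measurable_pi_apply w).comp (hX 0)
  | Sum.inr q => (measurable_pi_apply q.2).comp (hY q.1)

lemma identDistrib_obsField_spaceShift (hinv : IsTranslationInvariantLaw μ X Y) (w : ℤ) :
    IdentDistrib (fun ω i => obsField X Y i ω) (fun ω i => obsField X Y (spaceShift w i) ω)
      μ μ := by
  have hm : Measurable fun (x : ℤ → ℤ → ℤˣ × ℤˣ) (i : SpaceTime) =>
      Sum.elim (fun w => (x 0 w).1) (fun q : ℤ × ℤ => (x q.1 q.2).2) i := by
    refine measurable_pi_lambda _ ?_
    rintro (u | ⟨j, u⟩)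
    · exact measurable_fst.comp ((measurable_pi_apply u).comp (measurable_pi_apply 0))
    · exact measurable_snd.comp ((measurable_pi_apply u).comp (measurable_pi_apply j))
  convert (hinv 0 w).comp hm using 1
  · ext ω (u | ⟨j, u⟩) <;> rfl
  · ext ω (u | ⟨j, u⟩) <;> simp [obsField, spaceShift]

lemma identDistrib_state (hinv : IsTranslationInvariantLaw μ X Y) (k : ℤ) :
    IdentDistrib (X 0) (X k) μ μ := by
  have hm : Measurable fun (x : ℤ → ℤ → ℤˣ × ℤˣ) (u : ℤ) => (x 0 u).1 :=
    measurable_pi_lambda _ fun u =>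
      measurable_fst.comp ((measurable_pi_apply u).comp (measurable_pi_apply 0))
  convert (hinv k 0).comp hm using 1
  · rfl
  · funext ω u
    simp only [Function.comp_apply, zero_add, add_zero]

lemma obsSigma_eq_fieldSigma (X Y : ℤ → Ω → Conf) (k v : ℤ) :
    obsSigma Y k v = fieldSigma (obsField X Y) (obsPast k v) := by
  refine le_antisymm (sup_le (iSup₂_le fun j hj => ?_) (iSup₂_le fun w hw => ?_))
    (iSup₂_le ?_)
  · have e : MeasurableSpace.comap (Y j) inferInstance
        = fieldSigma (obsField X Y) (Set.range fun u => Sum.inr (j, u)) :=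
      comap_tuple (obsField X Y) fun u => Sum.inr (j, u)
    rw [e]
    refine fieldSigma_mono _ ?_
    rintro _ ⟨u, rfl⟩
    exact Or.inl hj
  · exact le_biSup (f := fun i => MeasurableSpace.comap (obsField X Y i) inferInstance)
      (show Sum.inr (k, w) ∈ obsPast k v from Or.inr ⟨rfl, hw⟩)
  · rintro (u | ⟨j, u⟩) h
    · exact h.elim
    · rcases h with h | ⟨rfl, h⟩
      · refine le_sup_of_le_left (le_trans ?_ (le_iSup₂_of_le j h le_rfl))
        exact ((measurable_pi_apply u).comp (comap_measurable (Y j))).comap_le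
      · exact le_sup_of_le_right (le_iSup₂_of_le (f := fun w (_ : w < v) =>
          MeasurableSpace.comap (fun ω => Y j ω w) inferInstance) u h le_rfl)

lemma comap_sup_obsSigma_eq_fieldSigma (X Y : ℤ → Ω → Conf) (k v : ℤ) :
    MeasurableSpace.comap (X 0) inferInstance ⊔ obsSigma Y k v
      = fieldSigma (obsField X Y) (fullPast k v) := by
  rw [fieldSigma_fullPast, obsSigma_eq_fieldSigma X, ← comap_tuple]
  rfl

/-- The past contains no observation at time `k` and sites `≥ v`, so the noise there can be
integrated out. -/
lemma fieldSigma_fullPast_le_restSigma (hobs : IsDirectObservation μ p X Y ξ) (k v : ℤ) :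
    fieldSigma (obsField X Y) (fullPast k v) ≤ restSigma X ξ k v := by
  have hXm : ∀ j u, Measurable[restSigma X ξ k v] fun ω => X j ω u := fun j u => by
    refine Measurable.mono (ma := MeasurableSpace.comap (fun ω k => X k ω) inferInstance) ?_
      le_sup_right le_rfl
    have hc : Measurable fun x : ℤ → Conf => x j u :=
      (measurable_pi_apply u).comp (measurable_pi_apply j)
    exact hc.comp (comap_measurable fun ω k => X k ω)
  refine iSup₂_le ?_
  rintro (u | ⟨j, u⟩) h
  · exact (hXm 0 u).comap_le
  · have hn : (j, u) ∈ {q : ℤ × ℤ | q.1 = k ∧ v ≤ q.2}ᶜ := by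
      rintro ⟨rfl, h2⟩
      rcases h with h | h
      · exact absurd h.2 (by simp)
      · exact absurd h.2 (not_lt.2 h2)
    have hξm : Measurable[restSigma X ξ k v] fun ω => ξ j ω u :=
      (measurable_fieldSigma (fun (q : ℤ × ℤ) ω => ξ q.1 ω q.2) hn).mono le_sup_left le_rfl
    have hY : Measurable[restSigma X ξ k v] fun ω => Y j ω u := by
      simp only [hobs.observation_eq]
      exact (Measurable.of_discrete (f := fun q : ℤˣ × ℤˣ => q.1 * q.2)).comp
        ((hXm j u).prodMk hξm)
    exact hY.comap_le

lemma siteProd_observation (hobs : IsDirectObservation μ p X Y ξ) (J : Finset ℤ) (k : ℤ) (ω : Ω) :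
    siteProd J (Y k ω) = siteProd J (X k ω) * siteProd J (ξ k ω) := by
  rw [← siteProd_mul]
  congr 1
  ext u
  rw [hobs.observation_eq]

variable [IsProbabilityMeasure μ] (hX : ∀ k, Measurable (X k)) (hY : ∀ k, Measurable (Y k))
  (hobs : IsDirectObservation μ p X Y ξ) (hinv : IsTranslationInvariantLaw μ X Y)

include hX hY hinv in
lemma vanishingCondGap_siteProd_observation {v : ℤ} {J : Finset ℤ} (hJ : ∀ u ∈ J, v ≤ u) :
    VanishingCondGap μ (fun k => fieldSigma (obsField X Y) (fullPast k v))
      (fun k => fieldSigma (obsField X Y) (obsPast k v)) fun k ω => siteProd J (Y k ω) := by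
  obtain ⟨b, hb⟩ := J.bddAbove
  have h := vanishingCondGap_obsTuple (measurable_obsField hX hY)
    (identDistrib_obsField_spaceShift hinv) v (b - v + 1).toNat
    -- The block `[v, b]` contains `J`; the default value `1` is never read at a site of `J`.
    fun w => siteProd J fun u => if h : (u - v).toNat < (b - v + 1).toNat
      then w ⟨(u - v).toNat, h⟩ else 1
  convert h using 3 with k ω
  refine dependsOn_siteProd J fun u hu => ?_
  have h1 := hJ u hu
  have h2 := hb hu
  rw [dif_pos (by omega)]
  change Y k ω u = Y k ω (v + ((u - v).toNat : ℤ))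
  congr 1
  omega

include hX hobs in
lemma condExp_siteProd_noise_of_le {v : ℤ} {S : ℤ → Set SpaceTime}
    (hS : ∀ k, S k ⊆ fullPast k v) {f : Conf → ℝ} {K J : Finset ℤ} (hf : DependsOn f K)
    (hJ : ∀ u ∈ J, v ≤ u) (k : ℤ) :
    μ[fun ω => f (X k ω) * siteProd J (ξ k ω) | fieldSigma (obsField X Y) (S k)] =ᵐ[μ]
      fun ω => (1 - 2 * p) ^ J.card
        * (μ[fun ω => f (X k ω) | fieldSigma (obsField X Y) (S k)]) ω := by
  obtain ⟨C, hC⟩ := exists_bound_of_dependsOn hf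
  exact condExp_mul_siteProd_noise hobs hX ((fieldSigma_mono _ (hS k)).trans
    (fieldSigma_fullPast_le_restSigma hobs k v)) (measurable_of_dependsOn hf) hC hJ

include hX hobs in
lemma condGap_mul_siteProd_noise {v : ℤ} {f : Conf → ℝ} {K J : Finset ℤ} (hf : DependsOn f K)
    (hJ : ∀ u ∈ J, v ≤ u) (k : ℤ) :
    condGap μ (fieldSigma (obsField X Y) (fullPast k v)) (fieldSigma (obsField X Y) (obsPast k v))
        (fun ω => f (X k ω) * siteProd J (ξ k ω))
      = |(1 - 2 * p) ^ J.card| * condGap μ (fieldSigma (obsField X Y) (fullPast k v))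
        (fieldSigma (obsField X Y) (obsPast k v)) (fun ω => f (X k ω)) :=
  condGap_of_condExp_eq
    (condExp_siteProd_noise_of_le hX hobs (S := fun k => fullPast k v) (fun _ => subset_rfl) hf hJ k)
    (condExp_siteProd_noise_of_le hX hobs (S := fun k => obsPast k v)
      (fun k => obsPast_subset_fullPast k v) hf hJ k)

lemma integrable_comp_of_dependsOn {f : Conf → ℝ} {K : Finset ℤ} (hf : DependsOn f K)
    {W : Ω → Conf} (hW : Measurable W) : Integrable (fun ω => f (W ω)) μ := by
  obtain ⟨C, hC⟩ := exists_bound_of_dependsOn hf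
  exact Integrable.of_bound ((measurable_of_dependsOn hf).comp hW).aestronglyMeasurable C
    (ae_of_all _ fun ω => hC _)

-- For a product of spins over `J`, the gap for `Y_k` is `|1 - 2p|^|J|` times the gap for `X_k`;
-- dividing by this constant transfers the convergence to the state.
include hX hY hobs hinv in
lemma vanishingCondGap_state (hp : p ≠ 1 / 2) {v : ℤ} {f : Conf → ℝ} {K : Finset ℤ}
    (hf : DependsOn f K) (hK : ∀ u ∈ K, v ≤ u) :
    VanishingCondGap μ (fun k => fieldSigma (obsField X Y) (fullPast k v))
      (fun k => fieldSigma (obsField X Y) (obsPast k v)) fun k ω => f (X k ω) := by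
  refine dependsOn_induction (P := fun f => VanishingCondGap μ
    (fun k => fieldSigma (obsField X Y) (fullPast k v))
    (fun k => fieldSigma (obsField X Y) (obsPast k v)) fun k ω => f (X k ω))
    (fun f g hf hg => hf.add hg) (fun c f hf => hf.const_mul c) K (fun J hJ => ?_) hf
  have hJv : ∀ u ∈ J, v ≤ u := fun u hu => hK u (hJ hu)
  refine ⟨fun k => integrable_comp_of_dependsOn (dependsOn_siteProd J) (hX k), ?_⟩
  have h := (vanishingCondGap_siteProd_observation hX hY hinv hJv).2
  simp only [siteProd_observation hobs,
    condGap_mul_siteProd_noise hX hobs (dependsOn_siteProd J) hJv] at h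
  have hc : |(1 - 2 * p) ^ J.card| ≠ 0 :=
    abs_ne_zero.2 (pow_ne_zero _ fun h0 => hp (by linarith))
  have h' := h.const_mul |(1 - 2 * p) ^ J.card|⁻¹
  simpa only [inv_mul_cancel_left₀ hc, mul_zero] using h'

-- Expand `g` in products of spins. Each term is a function of `X_k` on `K ∪ J` times a product of
-- noise, so it reduces to `vanishingCondGap_state`.
include hX hY hobs hinv in
lemma vanishingCondGap_state_mul_observation (hp : p ≠ 1 / 2) {v : ℤ} {f g : Conf → ℝ}
    {K K' : Finset ℤ} (hf : DependsOn f K) (hK : ∀ u ∈ K, v ≤ u) (hg : DependsOn g K')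
    (hK' : ∀ u ∈ K', v ≤ u) :
    VanishingCondGap μ (fun k => fieldSigma (obsField X Y) (fullPast k v))
      (fun k => fieldSigma (obsField X Y) (obsPast k v)) fun k ω => f (X k ω) * g (Y k ω) := by
  classical
  refine dependsOn_induction (P := fun g => VanishingCondGap μ
    (fun k => fieldSigma (obsField X Y) (fullPast k v))
    (fun k => fieldSigma (obsField X Y) (obsPast k v)) fun k ω => f (X k ω) * g (Y k ω))
    (fun g h hg hh => ?_) (fun c g hg => ?_) K' (fun J hJ => ?_) hg
  · simpa only [mul_add] using hg.add hh
  · simpa only [mul_left_comm] using hg.const_mul c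
  have hJv : ∀ u ∈ J, v ≤ u := fun u hu => hK' u (hJ hu)
  have hfJ : DependsOn (fun x => f x * siteProd J x) ((K ∪ J : Finset ℤ) : Set ℤ) :=
    fun x y hxy => by
      have h1 := hf fun u hu => hxy u (Finset.mem_union_left J hu)
      have h2 := dependsOn_siteProd J fun u hu => hxy u (Finset.mem_union_right K hu)
      dsimp only
      rw [h1, h2]
  have h := (vanishingCondGap_state hX hY hobs hinv hp hfJ fun u hu =>
    (Finset.mem_union.1 hu).elim (hK u) (hJv u)).2.const_mul |(1 - 2 * p) ^ J.card|
  refine ⟨fun k => (integrable_comp_of_dependsOn hf (hX k)).mul_of_top_left ?_, ?_⟩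
  · exact MemLp.of_bound ((measurable_siteProd J).comp (hY k)).aestronglyMeasurable 1
      (ae_of_all _ fun ω => (abs_siteProd J _).le)
  · simp only [siteProd_observation hobs, ← mul_assoc]
    simpa only [condGap_mul_siteProd_noise hX hobs hfJ hJv, mul_zero] using h

-- The pasts at `v + s` arise from those at `v` by adding `s` observations, so `f` may depend on
-- sites to the left of `v + s`. Bayes' formula reduces the claim to joint functions of `X_k` and
-- these observations.
include hX hY hobs hinv in
lemma tendsto_condGap_state (hp : p ≠ 1 / 2) {v : ℤ} (s : ℕ) {f : Conf → ℝ} {K : Finset ℤ}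
    (hf : DependsOn f K) (hK : ∀ u ∈ K, v ≤ u) :
    Tendsto (fun k : ℕ => condGap μ (fieldSigma (obsField X Y) (fullPast k (v + s)))
      (fieldSigma (obsField X Y) (obsPast k (v + s))) fun ω => f (X k ω)) atTop (𝓝 0) := by
  classical
  have hZ := measurable_obsField hX hY
  obtain ⟨C, hC⟩ := exists_bound_of_dependsOn hf
  have hC0 : 0 ≤ C := (abs_nonneg _).trans (hC 1)
  have hind : ∀ (a : Fin s → ℤˣ) (f : Conf → ℝ) (k : ℕ),
      (obsTuple (obsField X Y) k v s ⁻¹' {a}).indicator (fun ω => f (X k ω))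
        = fun ω => f (X k ω) * if (fun i : Fin s => Y k ω (v + (i : ℤ))) = a then 1 else 0 := by
    intro a f k
    ext ω
    rw [mul_ite, mul_one, mul_zero, Set.indicator_apply]
    exact if_congr Iff.rfl rfl rfl
  have hgap : ∀ (a : Fin s → ℤˣ) (f : Conf → ℝ), DependsOn f K →
      Tendsto (fun k : ℕ => condGap μ (fieldSigma (obsField X Y) (fullPast k v))
        (fieldSigma (obsField X Y) (obsPast k v))
        ((obsTuple (obsField X Y) k v s ⁻¹' {a}).indicator fun ω => f (X k ω))) atTop (𝓝 0) := by
    intro a f hf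
    simp only [hind]
    refine (vanishingCondGap_state_mul_observation hX hY hobs hinv hp hf hK
      (g := fun y => if (fun i : Fin s => y (v + (i : ℤ))) = a then 1 else 0)
      (K' := Finset.Ico v (v + s)) (fun x y hxy => ?_) fun u hu => (Finset.mem_Ico.1 hu).1).2
    have e : (fun i : Fin s => x (v + (i : ℤ))) = fun i : Fin s => y (v + (i : ℤ)) := by
      ext i
      rw [hxy _ (Finset.mem_coe.2 (Finset.mem_Ico.2 ⟨by omega, by omega⟩))]
    dsimp only
    rw [e]
  have hlim := tendsto_finsetSum Finset.univ fun (a : Fin s → ℤˣ) _ =>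
    -- The constant function `1` accounts for the conditional law of the added observations in
    -- `condGap_sup_comap_le`.
    (hgap a f hf).add ((hgap a (fun _ => 1) fun _ _ _ => rfl).const_mul C)
  simp only [mul_zero, add_zero, Finset.sum_const_zero] at hlim
  refine squeeze_zero (fun _ => condGap_nonneg _) (fun k => ?_) hlim
  rw [← fieldSigma_fullPast_sup, ← fieldSigma_obsPast_sup]
  exact condGap_sup_comap_le (fieldSigma_le hZ _)
    (fieldSigma_mono _ (obsPast_subset_fullPast k v)) (measurable_obsTuple hZ k v s)
    (integrable_comp_of_dependsOn hf (hX k)) hC0 fun ω => hC _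

include hX hY hobs hinv in
lemma tendsto_condGap_state_indicator (hp : p ≠ 1 / 2) (v : ℤ) {A : Set Conf}
    (hA : MeasurableSet A) :
    Tendsto (fun k : ℕ => condGap μ (fieldSigma (obsField X Y) (fullPast k v))
      (fieldSigma (obsField X Y) (obsPast k v)) ((X k ⁻¹' A).indicator fun _ => 1))
      atTop (𝓝 0) := by
  have hprob : IsProbabilityMeasure (μ.map (X 0)) :=
    Measure.isProbabilityMeasure_map (hX 0).aemeasurable
  have hdense : (μ.map (X 0)).MeasureDense (measurableCylinders fun _ : ℤ => ℤˣ) :=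
    Measure.MeasureDense.of_generateFrom_isSetAlgebra_finite _ isSetAlgebra_measurableCylinders
      generateFrom_measurableCylinders.symm
  rw [Metric.tendsto_atTop]
  intro ε hε
  -- The approximation is made under the law of `X 0`, which is that of every `X k`, so a single
  -- cylinder serves all times. The final bound is `ε/2 + 2 · ε/4`.
  obtain ⟨t, ht, hAt⟩ := hdense.approx A hA (measure_ne_top _ _) (ε / 4) (by positivity)
  have htm := hdense.measurable t ht
  obtain ⟨K, S, hS, rfl⟩ := (mem_measurableCylinders t).1 ht
  -- A site `v₀` to the left of `v` and of every site of the cylinder.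
  obtain ⟨v₀, hv₀⟩ := (insert v K).bddBelow
  have hv : v = v₀ + ((v - v₀).toNat : ℤ) := by
    have := hv₀ (Finset.mem_coe.2 (Finset.mem_insert_self v K))
    omega
  have hdep : DependsOn ((cylinder (α := fun _ => ℤˣ) K S).indicator fun _ => (1 : ℝ)) K := fun x y hxy => by
    have e : K.restrict x = K.restrict y := funext fun u => hxy u u.2
    have h : x ∈ cylinder (α := fun _ => ℤˣ) K S ↔ y ∈ cylinder (α := fun _ => ℤˣ) K S := by
      rw [mem_cylinder, mem_cylinder]
      exact iff_of_eq (congrArg (· ∈ S) e)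
    by_cases hx : x ∈ cylinder (α := fun _ => ℤˣ) K S
    · rw [Set.indicator_of_mem hx, Set.indicator_of_mem (h.1 hx)]
    · rw [Set.indicator_of_notMem hx, Set.indicator_of_notMem (mt h.2 hx)]
  have hlim := tendsto_condGap_state hX hY hobs hinv hp (v := v₀) (v - v₀).toNat hdep
    fun u hu => hv₀ (Finset.mem_coe.2 (Finset.mem_insert_of_mem hu))
  rw [← hv, Metric.tendsto_atTop] at hlim
  obtain ⟨N, hN⟩ := hlim (ε / 2) (by positivity)
  refine ⟨N, fun k hk => ?_⟩
  have h1 := hN k hk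
  rw [Real.dist_eq, sub_zero, abs_of_nonneg (condGap_nonneg _)] at h1 ⊢
  have h2 := condGap_le_add (F := fieldSigma (obsField X Y) (fullPast k v))
    (G := fieldSigma (obsField X Y) (obsPast k v))
    (integrable_indicator_one (μ := μ) (hX k hA))
    (integrable_comp_of_dependsOn (μ := μ) hdep (hX k))
  have h3 : ∫ ω, |(X k ⁻¹' A).indicator (fun _ => (1 : ℝ)) ω
      - (cylinder K S).indicator (fun _ => (1 : ℝ)) (X k ω)| ∂μ
      = (μ.map (X 0)).real (symmDiff A (cylinder K S)) := by
    have e : ∀ ω, |(X k ⁻¹' A).indicator (fun _ => (1 : ℝ)) ω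
        - (cylinder K S).indicator (fun _ => (1 : ℝ)) (X k ω)|
        = (X k ⁻¹' symmDiff A (cylinder K S)).indicator (fun _ => (1 : ℝ)) ω := fun ω => by
      by_cases hA : X k ω ∈ A <;> by_cases hB : X k ω ∈ cylinder K S <;>
        simp [Set.mem_symmDiff, hA, hB]
    simp only [e]
    have hm := hA.symmDiff htm
    rw [integral_indicator_const _ (hX k hm), smul_eq_mul, mul_one, (identDistrib_state hinv k).map_eq,
      map_measureReal_apply (hX k) hm]
  have h4 : (μ.map (X 0)).real (symmDiff A (cylinder K S)) < ε / 4 :=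
    ENNReal.toReal_lt_of_lt_ofReal hAt
  rw [h3] at h2
  linarith

end Filtering

theorem mainTheorem4 {Ω : Type*} [MeasurableSpace Ω] (μ : Measure Ω) [IsProbabilityMeasure μ]
    (P : Kernel Conf Conf) (Ploc : ℤ → Kernel Conf ℤˣ) [∀ v, IsMarkovKernel (Ploc v)]
    (Φ : Kernel (Conf × Conf) Conf) (Φloc : ℤ → Kernel (Conf × Conf) ℤˣ)
    [∀ v, IsMarkovKernel (Φloc v)]
    (X Y ξ : ℤ → Ω → Conf) (p : ℝ)
    (hmm : IsHiddenMarkovModel μ P Φ X Y)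
    (hP : IsLocalTransition P Ploc) (hΦ : IsLocalObservation Φ Φloc)
    (hobs : IsDirectObservation μ p X Y ξ)
    (hcov : IsTranslationCovariant Ploc)
    (hinv : IsTranslationInvariantLaw μ X Y)
    (hp : p ≠ 1 / 2)
    (A : Set Conf) (hA : MeasurableSet A) (v : ℤ) :
    Tendsto
      (fun k : ℕ => eLpNorm
        (fun ω =>
          |(μ⟦X k ⁻¹' A | MeasurableSpace.comap (X 0) inferInstance ⊔ obsSigma Y k v⟧) ω -
            (μ⟦X k ⁻¹' A | obsSigma Y k v⟧) ω|) 1 μ)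
      atTop (𝓝 0) := by
  have h := ENNReal.tendsto_ofReal (tendsto_condGap_state_indicator hmm.measurable_state
    hmm.measurable_observation hobs hinv hp v hA)
  rw [ENNReal.ofReal_zero] at h
  refine h.congr fun k => ?_
  rw [comap_sup_obsSigma_eq_fieldSigma, obsSigma_eq_fieldSigma X, eLpNorm_one_eq_lintegral_enorm,
    ← ofReal_integral_norm_eq_lintegral_enorm (integrable_condGap _)]
  simp only [Real.norm_eq_abs, abs_abs]
  rfl
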